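/- Let \(\Bbbk\) be a field, \(Q\) a finitely generated commutative monoid (written additively), and \(\Bbbk[Q]=\bigoplus_{q\in Q}\Bbbk\,\mathbf t^q\) its monoid algebra. A binomial ideal is an ideal generated by elements \(\mathbf t^p-\lambda\mathbf t^q\) with \(p,q\in Q\) and \(\lambda\in\Bbbk\) (possibly \(\lambda=0\)). An ideal \(I\) induces the congruence \(\sim_I\) on \(Q\) in which \(p\sim_I q\) if and only if \(\mathbf t^p-\lambda\mathbf t^q\in I\) for some \(\lambda\in\Bbbk^*\). In a commutative monoid, an element \(x\) is nil if \(q+x=x\) for all \(q\); \(q\) is nilpotent if some multiple \(nq\), \(n\in\mathbb N\), is nil; \(q\) is cancellative if \(q+a=q+b\) implies \(a=b\); and \(q\) is partly cancellative if, for all cancellative \(a,b\) such that \(q+a=q+b\) is not nil, \(a=b\). A congruence \(\sim\) on \(Q\), with quotient \(\overline Q=Q/{\sim}\), is - primary if every element of \(\overline Q\) is nilpotent or cancellative; - mesoprimary if it is primary and every element of \(\overline Q\) is partly cancellative; - primitive if it is mesoprimary and the cancellative elements of \(\overline Q\) are torsion-free (\(na=nb\) with \(n\ge 1\) implies \(a=b\));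 - prime if every element of \(\overline Q\) is nil or cancellative; - toric if the non-nil elements of \(\overline Q\) form an affine semigroup (a monoid isomorphic to a finitely generated submonoid of a free abelian group), or \(\overline Q\) is trivial. A binomial ideal \(I\subseteq\Bbbk[Q]\) is - cellular if it is proper and every monomial \(\mathbf t^q\) is either a nonzerodivisor or nilpotent in \(\Bbbk[Q]/I\); - mesoprimary if it is maximal among the proper binomial ideals inducing some given mesoprimary congruence; - primary if \(\Bbbk[Q]/I\) has precisely one associated prime; - mesoprime if it is the kernel of a \(\Bbbk\)-algebra homomorphism, taking each monomial to a homogeneous element (possibly \(0\)), from \(\Bbbk[Q]\) to a twisted group algebra over \(\Bbbk\), that is, to a \(\Bbbk\)-algebra graded by an abelian group \(G\) that becomes isomorphic, over the algebraic closure \(\overline\Bbbk\), to the group algebra \(\overline\Bbbk[G]\) via a \(G\)-graded isomorphism; - prime if \(\Bbbk[Q]/I\) is an integral domain. **Theorem.** Let \(I\subseteq\Bbbk[Q]\) be a binomial ideal. Call \(I\) *maximal for its congruence* if \(I\) is maximal among the proper binomial ideals of \(\Bbbk[Q]\) that induce \(\sim_I\). 1. \(I\) is cellular if and only if \(\sim_I\)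 is primary and \(I\) is maximal for its congruence. 2. \(I\) is mesoprimary if and only if \(\sim_I\) is mesoprimary and \(I\) is maximal for its congruence. 3. \(I\) is mesoprime if and only if \(\sim_I\) is prime and \(I\) is maximal for its congruence. 4. If \(\Bbbk\) is algebraically closed, then \(I\) is prime if and only if \(\sim_I\) is toric and \(I\) is maximal for its congruence. 5. If \(\sim_I\) is primitive and \(I\) is maximal for its congruence, then \(I\) is primary. Conversely, if \(\Bbbk\) is algebraically closed of characteristic \(0\) and \(I\) is primary, then \(\sim_I\) is primitive and \(I\) is maximal for its congruence. -/

import Mathlib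

open scoped TensorProduct

namespace BinomialIdeals

/-! ### Elements of commutative monoids -/

section Monoid

variable {M : Type*} [AddCommMonoid M]

/-- An element of a commutative monoid is nil if it is absorbing. -/
def IsNil (x : M) : Prop := ∀ q : M, q + x = x

/-- An element is nilpotent if one of its multiples is nil. -/
def IsNilpotentElt (q : M) : Prop := ∃ n : ℕ, IsNil (n • q)

/-- An element is cancellative if addition by it is injective. -/
def IsCancellative (q : M) : Prop := ∀ a b : M, q + a = q + b → a = b

/-- An element `q` is partly cancellative if `q + a = q + b ≠ nil` implies `a = b` for all
cancellative `a`, `b`. -/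
def IsPartlyCancellative (q : M) : Prop :=
  ∀ a b : M, IsCancellative a → IsCancellative b → q + a = q + b → ¬ IsNil (q + a) → a = b

/-- A set of elements is torsion-free if `n • a = n • b` implies `a = b`, for `n ≥ 1` and `a`, `b`
in the set. -/
def TorsionFreeOn (s : Set M) : Prop :=
  ∀ a ∈ s, ∀ b ∈ s, ∀ n : ℕ, 1 ≤ n → n • a = n • b → a = b

variable (M) in
/-- An affine semigroup is a monoid isomorphic to a finitely generated submonoid of a free abelian
group. -/
def IsAffineSemigroup : Prop :=
  ∃ (ι : Type) (N : AddSubmonoid (ι →₀ ℤ)), N.FG ∧ Nonempty (M ≃+ N)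

end Monoid

/-! ### Congruences -/

section Congruence

variable {Q : Type*} [AddCommMonoid Q]

/-- A congruence is primary if every element of the quotient is nilpotent or cancellative. -/
def IsPrimaryCon (c : AddCon Q) : Prop :=
  ∀ x : c.Quotient, IsNilpotentElt x ∨ IsCancellative x

/-- A congruence is mesoprimary if it is primary and every element of the quotient is partly
cancellative. -/
def IsMesoprimaryCon (c : AddCon Q) : Prop :=
  IsPrimaryCon c ∧ ∀ x : c.Quotient, IsPartlyCancellative x

/-- A congruence is primitive if it is mesoprimary and the cancellative elements of the quotient
form a torsion-free set. -/
def IsPrimitiveCon (c : AddCon Q) : Prop :=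
  IsMesoprimaryCon c ∧ TorsionFreeOn {x : c.Quotient | IsCancellative x}

/-- A congruence is prime if every element of the quotient is nil or cancellative. -/
def IsPrimeCon (c : AddCon Q) : Prop :=
  ∀ x : c.Quotient, IsNil x ∨ IsCancellative x

/-- A congruence is toric if the non-nil elements of the quotient form an affine semigroup.
The identity element is always counted in; this matters only for the one-element quotient (whose
identity is nil), which is thereby the trivial affine semigroup. -/
def IsToricCon (c : AddCon Q) : Prop :=
  ∃ S : AddSubmonoid c.Quotient, (∀ x, x ∈ S ↔ (¬ IsNil x ∨ x = 0)) ∧ IsAffineSemigroup S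

end Congruence

/-! ### Binomial ideals in monoid algebras -/

section Algebra

universe u v

variable {k : Type v} [Field k] {Q : Type u} [AddCommMonoid Q]

variable (k) in
/-- The monomial `t ^ q` of the monoid algebra `k[Q]`. -/
noncomputable def monomial (q : Q) : AddMonoidAlgebra k Q := AddMonoidAlgebra.single q 1

/-- A binomial ideal is an ideal generated by elements `t ^ p - l • t ^ q` with `l` a scalar,
possibly zero. -/
def IsBinomialIdeal (I : Ideal (AddMonoidAlgebra k Q)) : Prop :=
  ∃ B : Set (AddMonoidAlgebra k Q),
    (∀ f ∈ B, ∃ (p q : Q) (l : k), f = monomial k p - l • monomial k q) ∧ I = Ideal.span B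

/-- The congruence induced by an ideal: `p ∼ q` if `t ^ p - l • t ^ q` lies in the ideal for some
nonzero scalar `l`. -/
def inducedCon (I : Ideal (AddMonoidAlgebra k Q)) : AddCon Q where
  r p q := ∃ l : k, l ≠ 0 ∧ monomial k p - l • monomial k q ∈ I
  iseqv :=
    { refl := fun p => ⟨1, one_ne_zero, by simp⟩
      symm := by
        rintro p q ⟨l, hl, h⟩
        refine ⟨l⁻¹, inv_ne_zero hl, ?_⟩
        have h2 := Submodule.smul_of_tower_mem I (-l⁻¹) h
        rw [smul_sub, smul_smul, neg_mul, inv_mul_cancel₀ hl] at h2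
        convert h2 using 1
        module
      trans := by
        rintro p q r ⟨l, hl, h⟩ ⟨m, hm, h'⟩
        refine ⟨l * m, mul_ne_zero hl hm, ?_⟩
        have h2 := I.add_mem h (Submodule.smul_of_tower_mem I l h')
        convert h2 using 1
        module }
  add' := by
    rintro p q r s ⟨l, hl, h⟩ ⟨m, hm, h'⟩
    refine ⟨l * m, mul_ne_zero hl hm, ?_⟩
    have key : ∀ a b : Q, monomial k (a + b) = monomial k a * monomial k b := fun a b => by
      simp [monomial, AddMonoidAlgebra.single_mul_single]
    have h2 := I.add_mem (I.mul_mem_right (monomial k r) h)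
      (I.mul_mem_left (l • monomial k q) h')
    convert h2 using 1
    rw [key, key]
    simp only [sub_mul, mul_sub, smul_mul_assoc, mul_smul_comm, smul_smul]
    rw [mul_comm m l]
    abel

/-- `I` is maximal among the proper binomial ideals inducing the congruence `c`. -/
def IsMaximalInducing (c : AddCon Q) (I : Ideal (AddMonoidAlgebra k Q)) : Prop :=
  Maximal (fun J : Ideal (AddMonoidAlgebra k Q) =>
    IsBinomialIdeal J ∧ J ≠ ⊤ ∧ inducedCon J = c) I

/-- A proper ideal is cellular if every monomial in the quotient is a nonzerodivisor or
nilpotent. -/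
def IsCellularIdeal (I : Ideal (AddMonoidAlgebra k Q)) : Prop :=
  I ≠ ⊤ ∧ ∀ q : Q,
    Ideal.Quotient.mk I (monomial k q) ∈ nonZeroDivisors (AddMonoidAlgebra k Q ⧸ I) ∨
    IsNilpotent (Ideal.Quotient.mk I (monomial k q))

/-- An ideal is mesoprimary if it is maximal among the proper binomial ideals inducing a given
mesoprimary congruence. -/
def IsMesoprimaryIdeal (I : Ideal (AddMonoidAlgebra k Q)) : Prop :=
  ∃ c : AddCon Q, IsMesoprimaryCon c ∧ IsMaximalInducing c I

/-- An ideal is primary if the quotient has precisely one associated prime. -/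
def IsPrimaryIdeal (I : Ideal (AddMonoidAlgebra k Q)) : Prop :=
  ∃! p : Ideal (AddMonoidAlgebra k Q),
    p ∈ associatedPrimes (AddMonoidAlgebra k Q) (AddMonoidAlgebra k Q ⧸ I)

open Classical in
/-- A twisted group algebra over `k`: a `k`-algebra `R` graded by a group `G` (with graded pieces
`𝒜 g`) that becomes isomorphic to the group algebra over the algebraic closure of `k`, via a
`G`-graded isomorphism. -/
def IsTwistedGroupAlgebra {G : Type*} [AddCommGroup G] {R : Type*} [CommRing R] [Algebra k R]
    (𝒜 : G → Submodule k R) : Prop :=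
  Nonempty (GradedAlgebra 𝒜) ∧
  ∃ e : (AlgebraicClosure k ⊗[k] R) ≃ₐ[AlgebraicClosure k]
      AddMonoidAlgebra (AlgebraicClosure k) G,
    ∀ g : G, ((𝒜 g).baseChange (AlgebraicClosure k)).map e.toLinearMap =
      AddMonoidAlgebra.grade (AlgebraicClosure k) g

/-- An ideal is mesoprime if it is the kernel of a monomial homomorphism from `k[Q]` to a twisted
group algebra over `k`, that is, of a homomorphism taking each monomial to a homogeneous element
(possibly zero). -/
def IsMesoprimeIdeal (I : Ideal (AddMonoidAlgebra k Q)) : Prop :=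
  ∃ (G : Type u) (_ : AddCommGroup G) (R : Type (max u v)) (_ : CommRing R) (_ : Algebra k R)
    (𝒜 : G → Submodule k R) (φ : AddMonoidAlgebra k Q →ₐ[k] R),
    IsTwistedGroupAlgebra 𝒜 ∧ (∀ q : Q, ∃ g : G, φ (monomial k q) ∈ 𝒜 g) ∧
    I = RingHom.ker φ

/-- An ideal is prime if the quotient is an integral domain. -/
def IsPrimeIdeal (I : Ideal (AddMonoidAlgebra k Q)) : Prop :=
  IsDomain (AddMonoidAlgebra k Q ⧸ I)

end Algebra

end BinomialIdeals

/-! A binomial ideal `I` is homogeneous for the grading of `k[Q]` by the classes of `inducedCon I`,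
and each graded piece of `k[Q]/I` is spanned by any one monomial of its class. Comparing pieces
shows that a class is cancellative exactly when its monomials are nonzerodivisors modulo `I`
(`IsBinomialIdeal.isCancellative_iff`). Maximality for the congruence decides what becomes of the
nil class: unless the quotient monoid is trivial, it puts the nil monomials into `I`
(`IsMaximalInducing.monomial_mem_of_isNil`). Conversely a cellular ideal is maximal for its
congruence. Mesoprime, prime and primary ideals are all cellular, so their maximality comes for
free.

The bridge to group algebras is a character. Inverting all nonzerodivisors of `k[Q]/I` and extending
`kˣ → Kˣ` to the units of the resulting ring, which is possible because `Kˣ` is divisible for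
algebraically closed `K`, gives a homomorphism to the group algebra over `K` of the group of
differences of cancellative classes. Its kernel consists of the elements whose cancellative part
lies in `I` (`Character.mem_ker_iff`), so it is `I` itself when the congruence is prime and `I` is
maximal for it. For `K` the algebraic closure, the image lies in a twisted group algebra over `k`.
When the cancellative classes are torsion-free, the group algebra is a domain and the kernel is
prime.

For a primitive congruence, partial cancellativity lets this primality act on every translate of the
cancellative part. An element supported on cancellative exponents is then in `I` or a nonzerodivisor
modulo `I` (`mem_of_restrict_mul_mem`), while one supported on the other exponents is nilpotent, and
so `I` is primary. In the converse directions, roots of scalars exist in `k`, so a relation between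
`n • a` and `n • b` descends to one between `a` and `b` modulo a prime; in characteristic zero it
descends modulo a primary ideal as well. -/

namespace BinomialIdeals

universe u v

/-! ### Parts of an element supported on a set of exponents -/

section Restrict

variable {k : Type v} [Field k] {Q : Type u}

open Classical in
/-- The part of an element of the monoid algebra supported on a given set of exponents. -/
noncomputable def restrict (S : Set Q) : AddMonoidAlgebra k Q →ₗ[k] AddMonoidAlgebra k Q where
  toFun f := .ofCoeff (f.coeff.filter (· ∈ S))
  map_add' f g := by
    rw [AddMonoidAlgebra.coeff_add, Finsupp.filter_add, AddMonoidAlgebra.ofCoeff_add]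
  map_smul' r f := by
    rw [AddMonoidAlgebra.coeff_smul, Finsupp.filter_smul, AddMonoidAlgebra.ofCoeff_smul]; rfl

lemma restrict_monomial_of_mem {S : Set Q} {q : Q} (h : q ∈ S) :
    restrict S (monomial k q) = monomial k q := by
  classical
  simp [restrict, monomial, Finsupp.filter_single_of_pos (· ∈ S) h]

lemma restrict_monomial_of_notMem {S : Set Q} {q : Q} (h : q ∉ S) :
    restrict S (monomial k q) = 0 := by
  classical
  simp [restrict, monomial, Finsupp.filter_single_of_neg (· ∈ S) h]

lemma coeff_restrict_of_mem {S : Set Q} {q : Q} (h : q ∈ S) (f : AddMonoidAlgebra k Q) :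
    (restrict S f).coeff q = f.coeff q := by
  simp [restrict, h]

lemma coeff_restrict_of_notMem {S : Set Q} {q : Q} (h : q ∉ S) (f : AddMonoidAlgebra k Q) :
    (restrict S f).coeff q = 0 := by
  simp [restrict, h]

lemma sum_restrict_fiber {X : Type*} [DecidableEq X] (κ : Q → X) (f : AddMonoidAlgebra k Q) :
    ∑ x ∈ f.coeff.support.image κ, restrict (κ ⁻¹' {x}) f = f := by
  ext q
  rw [AddMonoidAlgebra.coeff_sum, Finsupp.finsetSum_apply]
  by_cases hq : f.coeff q = 0
  · rw [hq]
    refine Finset.sum_eq_zero fun x _ => ?_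
    by_cases h : q ∈ κ ⁻¹' {x}
    · rw [coeff_restrict_of_mem h, hq]
    · rw [coeff_restrict_of_notMem h]
  · rw [Finset.sum_eq_single (κ q), coeff_restrict_of_mem (S := κ ⁻¹' {κ q}) rfl]
    · intro x _ hx
      exact coeff_restrict_of_notMem (S := κ ⁻¹' {x}) (fun h => hx (Eq.symm h)) f
    · intro h
      exact absurd (Finset.mem_image_of_mem κ (Finsupp.mem_support_iff.2 hq)) h

end Restrict

/-! ### Homogeneity of binomial ideals; cancellative elements and nonzerodivisors -/

section Basic

variable {k : Type v} [Field k] {Q : Type u} [AddCommMonoid Q]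

lemma monomial_add (p q : Q) : monomial k (p + q) = monomial k p * monomial k q := by
  simp [monomial, AddMonoidAlgebra.single_mul_single]

lemma monomial_zero : monomial k (0 : Q) = 1 := rfl

lemma monomial_nsmul (n : ℕ) (q : Q) : monomial k (n • q) = monomial k q ^ n := by
  induction n with
  | zero => simp [monomial_zero]
  | succ n ih => rw [succ_nsmul, monomial_add, ih, pow_succ]

lemma single_eq_smul_monomial (q : Q) (r : k) :
    AddMonoidAlgebra.single q r = r • monomial k q := by
  simp [monomial]

@[elab_as_elim]
lemma monomial_induction {motive : AddMonoidAlgebra k Q → Prop} (f : AddMonoidAlgebra k Q)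
    (zero : motive 0) (add : ∀ f g, motive f → motive g → motive (f + g))
    (smul : ∀ (r : k) q, motive (r • monomial k q)) : motive f :=
  AddMonoidAlgebra.induction_linear f zero add fun q r => by
    rw [single_eq_smul_monomial]; exact smul r q

lemma restrict_compl_add (S : Set Q) (f : AddMonoidAlgebra k Q) :
    restrict S f + restrict Sᶜ f = f := by
  induction f using monomial_induction with
  | zero => simp
  | add f g hf hg => rw [map_add, map_add, add_add_add_comm, hf, hg]
  | smul r q =>
    by_cases h : q ∈ S
    · simp [restrict_monomial_of_mem h, restrict_monomial_of_notMem (S := Sᶜ) (not_not.2 h)]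
    · simp [restrict_monomial_of_notMem h, restrict_monomial_of_mem (S := Sᶜ) h]

/-- Restricting to `S` kills all monomials outside `S`, so properties of elements supported on `S`
can be checked on monomials in `S`. -/
lemma restrict_induction {motive : AddMonoidAlgebra k Q → Prop} (S : Set Q)
    (f : AddMonoidAlgebra k Q) (zero : motive 0)
    (add : ∀ f g, motive f → motive g → motive (f + g))
    (smul : ∀ (r : k), ∀ q ∈ S, motive (r • monomial k q)) : motive (restrict S f) := by
  induction f using monomial_induction with
  | zero => simpa using zero
  | add f g hf hg => rw [map_add]; exact add _ _ hf hg
  | smul r q =>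
    rw [map_smul]
    by_cases h : q ∈ S
    · rw [restrict_monomial_of_mem h]; exact smul r q h
    · rw [restrict_monomial_of_notMem h, smul_zero]; exact zero

lemma restrict_restrict (S T : Set Q) (f : AddMonoidAlgebra k Q) :
    restrict S (restrict T f) = restrict (S ∩ T) f := by
  induction f using monomial_induction with
  | zero => simp
  | add f g hf hg => simp only [map_add, hf, hg]
  | smul r q =>
    by_cases hT : q ∈ T
    · by_cases hS : q ∈ S
      · simp [restrict_monomial_of_mem, hS, hT]
      · simp [restrict_monomial_of_mem, restrict_monomial_of_notMem, hS, hT]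
    · simp [restrict_monomial_of_notMem, hT]

/-- Multiplication by elements supported on `S` commutes with restriction to `T`, if translation
by elements of `S` preserves membership in `T`. -/
lemma restrict_mul_restrict {S T : Set Q} (h : ∀ s ∈ S, ∀ q, s + q ∈ T ↔ q ∈ T)
    (g f : AddMonoidAlgebra k Q) :
    restrict T (restrict S g * f) = restrict S g * restrict T f := by
  refine restrict_induction (motive := fun g => restrict T (g * f) = g * restrict T f) S g
    (by simp) (fun g g' hg hg' => by rw [add_mul, map_add, hg, hg', add_mul]) fun r s hs => ?_
  · induction f using monomial_induction with
    | zero => simp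
    | add f f' hf hf' => rw [mul_add, map_add, hf, hf', map_add, mul_add]
    | smul r' q =>
      rw [smul_mul_smul_comm, map_smul, map_smul, ← monomial_add]
      by_cases hq : q ∈ T
      · rw [restrict_monomial_of_mem hq, restrict_monomial_of_mem ((h s hs q).2 hq),
          smul_mul_smul_comm, monomial_add]
      · rw [restrict_monomial_of_notMem hq, restrict_monomial_of_notMem (mt (h s hs q).1 hq)]
        simp

/-- An element lies in an ideal as soon as its parts supported on the fibres of some
map do. -/
lemma mem_of_forall_restrict_fiber_mem {X : Type*} (κ : Q → X) {I : Ideal (AddMonoidAlgebra k Q)}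
    {f : AddMonoidAlgebra k Q} (h : ∀ x, restrict (κ ⁻¹' {x}) f ∈ I) : f ∈ I := by
  classical
  rw [← sum_restrict_fiber κ f]
  exact I.sum_mem fun x _ => h x

lemma smul_mem_iff_mem {I : Ideal (AddMonoidAlgebra k Q)} {r : k} (hr : r ≠ 0)
    {f : AddMonoidAlgebra k Q} : r • f ∈ I ↔ f ∈ I := by
  refine ⟨fun h => ?_, fun h => Submodule.smul_of_tower_mem I r h⟩
  have := Submodule.smul_of_tower_mem I r⁻¹ h
  rwa [smul_smul, inv_mul_cancel₀ hr, one_smul] at this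

lemma inducedCon_of_mem {I : Ideal (AddMonoidAlgebra k Q)} {p q : Q} (hp : monomial k p ∈ I)
    (hq : monomial k q ∈ I) : inducedCon I p q :=
  ⟨1, one_ne_zero, by simpa using I.sub_mem hp hq⟩

lemma monomial_mem_of_inducedCon {I : Ideal (AddMonoidAlgebra k Q)} {p q : Q}
    (h : inducedCon I p q) (hp : monomial k p ∈ I) : monomial k q ∈ I := by
  obtain ⟨l, hl, h⟩ := h
  have := I.sub_mem hp h
  rwa [sub_sub_cancel, smul_mem_iff_mem hl] at this

/-- A binomial ideal is homogeneous with respect to every union of classes of its congruence. -/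
lemma IsBinomialIdeal.restrict_mem {I : Ideal (AddMonoidAlgebra k Q)} (hI : IsBinomialIdeal I)
    {S : Set Q} (hS : ∀ p q, inducedCon I p q → (p ∈ S ↔ q ∈ S)) {f : AddMonoidAlgebra k Q}
    (hf : f ∈ I) : restrict S f ∈ I := by
  obtain ⟨B, hB, hIB⟩ := hI
  -- Restriction is not linear over `k[Q]`, so a multiplier `a` is carried through the span
  -- induction. A generator then only meets monomials, and for `l ≠ 0` both terms of the product lie
  -- in one class.
  suffices H : ∀ a : AddMonoidAlgebra k Q, restrict S (a * f) ∈ I by simpa using H 1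
  have hf' : f ∈ Ideal.span B := hIB ▸ hf
  induction hf' using Submodule.span_induction with
  | zero => simp
  | add x y hx hy hx' hy' =>
    intro a
    rw [mul_add, map_add]
    exact I.add_mem (hx' (hIB ▸ hx) a) (hy' (hIB ▸ hy) a)
  | smul b x hx hx' =>
    intro a
    rw [smul_eq_mul, ← mul_assoc]
    exact hx' (hIB ▸ hx) _
  | mem b hb =>
    intro a
    obtain ⟨p, q, l, rfl⟩ := hB b hb
    induction a using monomial_induction with
    | zero => simp
    | add a a' ha ha' => rw [add_mul, map_add]; exact I.add_mem ha ha'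
    | smul r m =>
      have key : monomial k (m + p) - l • monomial k (m + q) ∈ I := by
        rw [monomial_add, monomial_add, ← mul_smul_comm, ← mul_sub]
        exact I.mul_mem_left _ hf
      rw [smul_mul_assoc, map_smul, mul_sub, mul_smul_comm, ← monomial_add, ← monomial_add]
      refine Submodule.smul_of_tower_mem I r ?_
      rw [map_sub, map_smul]
      by_cases hl : l = 0
      · subst hl
        rw [zero_smul, sub_zero] at key ⊢
        by_cases h : m + p ∈ S
        · rwa [restrict_monomial_of_mem h]
        · rw [restrict_monomial_of_notMem h]; exact I.zero_mem
      · have hmem := hS _ _ ⟨l, hl, key⟩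
        by_cases h : m + p ∈ S
        · rwa [restrict_monomial_of_mem h, restrict_monomial_of_mem (hmem.1 h)]
        · rw [restrict_monomial_of_notMem h, restrict_monomial_of_notMem (mt hmem.2 h)]
          simp

/-- The part of an element supported on a single class is congruent to a scaled monomial. -/
lemma exists_restrict_class_sub_mem (I : Ideal (AddMonoidAlgebra k Q)) (p : Q)
    (f : AddMonoidAlgebra k Q) :
    ∃ l : k, restrict {q | inducedCon I q p} f - l • monomial k p ∈ I := by
  refine restrict_induction (motive := fun f => ∃ l : k, f - l • monomial k p ∈ I)
    {q | inducedCon I q p} f ⟨0, by simp⟩ ?_ ?_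
  · intro f g hf hg
    obtain ⟨l, hl⟩ := hf
    obtain ⟨m, hm⟩ := hg
    refine ⟨l + m, ?_⟩
    convert I.add_mem hl hm using 1
    module
  · intro r q hq
    obtain ⟨l, -, h⟩ := hq
    refine ⟨r * l, ?_⟩
    rw [mul_smul, ← smul_sub]
    exact Submodule.smul_of_tower_mem I r h

lemma mem_of_forall_restrict_class_mem {I : Ideal (AddMonoidAlgebra k Q)}
    {f : AddMonoidAlgebra k Q} (h : ∀ p, restrict {q | inducedCon I q p} f ∈ I) : f ∈ I := by
  refine mem_of_forall_restrict_fiber_mem (I := I)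
    (fun q : Q => (q : (inducedCon I).Quotient)) fun x => ?_
  induction x using AddCon.induction_on with
  | H p =>
    have h' : (fun q : Q => (q : (inducedCon I).Quotient)) ⁻¹' {(p : (inducedCon I).Quotient)} =
      {q | inducedCon I q p} := Set.ext fun q => AddCon.eq _
    rw [h']
    exact h p

lemma mk_mem_nonZeroDivisors_iff {R : Type*} [CommRing R] {I : Ideal R} {x : R} :
    Ideal.Quotient.mk I x ∈ nonZeroDivisors (R ⧸ I) ↔ ∀ f, x * f ∈ I → f ∈ I := by
  rw [mem_nonZeroDivisors_iff_left]
  constructor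
  · intro h f hf
    rw [← Ideal.Quotient.eq_zero_iff_mem] at hf ⊢
    exact h _ (by rwa [← map_mul])
  · intro h y hy
    obtain ⟨f, rfl⟩ := Ideal.Quotient.mk_surjective y
    rw [← map_mul] at hy
    rw [Ideal.Quotient.eq_zero_iff_mem] at hy ⊢
    exact h f hy

lemma isCancellative_coe_iff {c : AddCon Q} {q : Q} :
    IsCancellative (q : c.Quotient) ↔ ∀ a b, c (q + a) (q + b) → c a b := by
  constructor
  · intro h a b hab
    exact (AddCon.eq c).1 (h a b ((AddCon.eq c).2 hab))
  · intro h a b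
    induction a using AddCon.induction_on with
    | H a =>
      induction b using AddCon.induction_on with
      | H b => exact fun hab => (AddCon.eq c).2 (h a b ((AddCon.eq c).1 hab))

lemma isNil_coe_iff {c : AddCon Q} {q : Q} :
    IsNil (q : c.Quotient) ↔ ∀ p, c (p + q) q := by
  constructor
  · intro h p
    exact (AddCon.eq c).1 (h p)
  · intro h p
    induction p using AddCon.induction_on with
    | H p => exact (AddCon.eq c).2 (h p)

lemma IsNil.eq {M : Type*} [AddCommMonoid M] {x y : M} (hx : IsNil x) (hy : IsNil y) : x = y := by
  rw [← hx y, add_comm, hy x]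

lemma IsCancellative.subsingleton_of_isNil {M : Type*} [AddCommMonoid M] {x : M}
    (hx : IsCancellative x) (hn : IsNil x) : Subsingleton M := by
  refine ⟨fun a b => hx a b ?_⟩
  rw [add_comm, hn, add_comm, hn]

lemma IsCancellative.isNil_of_isNil_add {M : Type*} [AddCommMonoid M] {x y : M}
    (hx : IsCancellative x) (hn : IsNil (x + y)) : IsNil y := fun q => hx _ _ <| by
  rw [add_left_comm, hn]

lemma IsNil.add {M : Type*} [AddCommMonoid M] {x : M} (hx : IsNil x) (y : M) : IsNil (y + x) := by
  rwa [hx]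

lemma isCancellative_add_iff {M : Type*} [AddCommMonoid M] {x y : M} :
    IsCancellative (x + y) ↔ IsCancellative x ∧ IsCancellative y := by
  refine ⟨fun h => ⟨fun a b hab => h a b ?_, fun a b hab => h a b ?_⟩,
    fun ⟨hx, hy⟩ a b hab => hy a b (hx _ _ ?_)⟩
  · rw [add_right_comm, hab, add_right_comm]
  · rw [add_assoc, hab, add_assoc]
  · rwa [← add_assoc, ← add_assoc]

lemma isCancellative_zero {M : Type*} [AddCommMonoid M] : IsCancellative (0 : M) :=
  fun a b h => by simpa using h

lemma isNil_of_monomial_mem {I : Ideal (AddMonoidAlgebra k Q)} {q : Q} (h : monomial k q ∈ I) :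
    IsNil (q : (inducedCon I).Quotient) :=
  isNil_coe_iff.2 fun p => inducedCon_of_mem
    (by rw [monomial_add]; exact I.mul_mem_left _ h) h

lemma isCancellative_of_forall_mem {I : Ideal (AddMonoidAlgebra k Q)} {q : Q}
    (h : ∀ f, monomial k q * f ∈ I → f ∈ I) : IsCancellative (q : (inducedCon I).Quotient) :=
  isCancellative_coe_iff.2 fun a b ⟨l, hl, hab⟩ => ⟨l, hl, h _ <| by
    rwa [mul_sub, mul_smul_comm, ← monomial_add, ← monomial_add]⟩

lemma monomial_mem_of_add_mem {I : Ideal (AddMonoidAlgebra k Q)} {q p : Q}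
    (hq : IsCancellative (q : (inducedCon I).Quotient)) (h : monomial k (q + p) ∈ I) :
    monomial k p ∈ I := by
  have hn : IsNil (p : (inducedCon I).Quotient) :=
    hq.isNil_of_isNil_add (isNil_of_monomial_mem h)
  exact monomial_mem_of_inducedCon (isNil_coe_iff.1 hn q) h

/-- Translation by a cancellative `q` keeps distinct classes distinct, so the part of the product on
the class of `q + p` comes only from the part of `f` on the class of `p`. That part is `l • t ^ p`
modulo `I`, and `l • t ^ (q + p) ∈ I` forces `l • t ^ p ∈ I`. -/
lemma IsBinomialIdeal.mem_of_monomial_mul_mem {I : Ideal (AddMonoidAlgebra k Q)}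
    (hI : IsBinomialIdeal I) {q : Q} (hq : IsCancellative (q : (inducedCon I).Quotient))
    {f : AddMonoidAlgebra k Q} (hf : monomial k q * f ∈ I) : f ∈ I := by
  refine mem_of_forall_restrict_class_mem fun p => ?_
  obtain ⟨l, hl⟩ := exists_restrict_class_sub_mem I p f
  have h1 : restrict {r | inducedCon I r (q + p)} (monomial k q * f) ∈ I :=
    hI.restrict_mem (fun a b hab => ⟨fun h => (inducedCon I).trans ((inducedCon I).symm hab) h,
      fun h => (inducedCon I).trans hab h⟩) hf
  have h2 : restrict {r | inducedCon I r (q + p)} (monomial k q * f) =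
      monomial k q * restrict {r | inducedCon I r p} f := by
    clear hf hl h1
    induction f using monomial_induction with
    | zero => simp
    | add f g hf hg => rw [mul_add, map_add, hf, hg, map_add, mul_add]
    | smul r a =>
      rw [mul_smul_comm, map_smul, map_smul, ← monomial_add, mul_smul_comm]
      by_cases ha : inducedCon I a p
      · rw [restrict_monomial_of_mem (S := {r | inducedCon I r p}) ha,
          restrict_monomial_of_mem (S := {r | inducedCon I r (q + p)})
            ((inducedCon I).add ((inducedCon I).refl q) ha), monomial_add]
      · rw [restrict_monomial_of_notMem (S := {r | inducedCon I r p}) ha,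
          restrict_monomial_of_notMem (S := {r | inducedCon I r (q + p)})
            (fun h => ha (isCancellative_coe_iff.1 hq a p h)), mul_zero]
  rw [h2] at h1
  have h3 := I.sub_mem h1 (I.mul_mem_left (monomial k q) hl)
  rw [← mul_sub, sub_sub_cancel, mul_smul_comm, ← monomial_add] at h3
  have h4 : l • monomial k p ∈ I := by
    by_cases h0 : l = 0
    · simp [h0]
    · rw [smul_mem_iff_mem h0] at h3 ⊢
      exact monomial_mem_of_add_mem hq h3
  simpa using I.add_mem hl h4

/-- An element of the quotient monoid is cancellative precisely if the corresponding monomial is a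
nonzerodivisor modulo the binomial ideal. -/
lemma IsBinomialIdeal.isCancellative_iff {I : Ideal (AddMonoidAlgebra k Q)}
    (hI : IsBinomialIdeal I) {q : Q} : IsCancellative (q : (inducedCon I).Quotient) ↔
      Ideal.Quotient.mk I (monomial k q) ∈ nonZeroDivisors (AddMonoidAlgebra k Q ⧸ I) := by
  rw [mk_mem_nonZeroDivisors_iff]
  exact ⟨fun h f => hI.mem_of_monomial_mul_mem h, isCancellative_of_forall_mem⟩

end Basic

/-! ### Cellular and mesoprimary ideals; maximality for the congruence -/

section Cellular

variable {k : Type v} [Field k] {Q : Type u} [AddCommMonoid Q]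

lemma IsBinomialIdeal.sup_span_monomial {I : Ideal (AddMonoidAlgebra k Q)}
    (hI : IsBinomialIdeal I) (q : Q) : IsBinomialIdeal (I ⊔ Ideal.span {monomial k q}) := by
  obtain ⟨B, hB, rfl⟩ := hI
  refine ⟨B ∪ {monomial k q}, ?_, (Ideal.span_union _ _).symm⟩
  rintro f (hf | rfl)
  · exact hB f hf
  · exact ⟨q, q, 0, by simp⟩

/-- Multiples of a nil monomial are supported on the nil class, so adjoining it changes nothing off
that class. -/
lemma IsBinomialIdeal.restrict_mem_of_mem_sup {I : Ideal (AddMonoidAlgebra k Q)}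
    (hI : IsBinomialIdeal I) {q : Q} (hq : IsNil (q : (inducedCon I).Quotient))
    {f : AddMonoidAlgebra k Q} (hf : f ∈ I ⊔ Ideal.span {monomial k q}) :
    restrict {p | ¬ inducedCon I p q} f ∈ I := by
  obtain ⟨i, hi, j, hj, rfl⟩ := Submodule.mem_sup.1 hf
  obtain ⟨a, rfl⟩ := Ideal.mem_span_singleton'.1 hj
  rw [map_add]
  refine I.add_mem (hI.restrict_mem ?_ hi) ?_
  · intro p r h
    exact not_congr ⟨fun h' => (inducedCon I).trans ((inducedCon I).symm h) h',
      fun h' => (inducedCon I).trans h h'⟩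
  · convert I.zero_mem
    clear hf hj
    induction a using monomial_induction with
    | zero => simp
    | add f g hf hg => rw [add_mul, map_add, hf, hg, add_zero]
    | smul r m =>
      rw [smul_mul_assoc, map_smul, ← monomial_add, restrict_monomial_of_notMem, smul_zero]
      exact not_not.2 (isNil_coe_iff.1 hq m)

lemma subsingleton_quotient_top :
    Subsingleton (inducedCon (⊤ : Ideal (AddMonoidAlgebra k Q))).Quotient := by
  refine ⟨fun a b => ?_⟩
  induction a using AddCon.induction_on with
  | H a =>
    induction b using AddCon.induction_on with
    | H b => exact (AddCon.eq _).2 (inducedCon_of_mem trivial trivial)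

lemma IsBinomialIdeal.sup_span_monomial_ne_top {I : Ideal (AddMonoidAlgebra k Q)}
    (hI : IsBinomialIdeal I) {q : Q} (hq : IsNil (q : (inducedCon I).Quotient))
    (hs : ¬ Subsingleton (inducedCon I).Quotient) : I ⊔ Ideal.span {monomial k q} ≠ ⊤ := by
  intro htop
  have h1 := hI.restrict_mem_of_mem_sup hq (f := monomial k 0) (by rw [htop]; trivial)
  rw [restrict_monomial_of_mem, monomial_zero] at h1
  · rw [← Ideal.eq_top_iff_one] at h1
    subst h1
    exact hs subsingleton_quotient_top
  · intro h
    refine hs (isCancellative_zero.subsingleton_of_isNil ?_)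
    rwa [← (AddCon.eq (inducedCon I)).2 h] at hq

lemma IsBinomialIdeal.inducedCon_sup_span_monomial {I : Ideal (AddMonoidAlgebra k Q)}
    (hI : IsBinomialIdeal I) {q : Q} (hq : IsNil (q : (inducedCon I).Quotient)) :
    inducedCon (I ⊔ Ideal.span {monomial k q}) = inducedCon I := by
  have hnil : ∀ p, monomial k p ∈ I → inducedCon I p q := fun p hp =>
    (AddCon.eq _).1 ((isNil_of_monomial_mem hp).eq hq)
  ext p r
  constructor
  · rintro ⟨l, hl, h⟩
    have h' := hI.restrict_mem_of_mem_sup hq h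
    rw [map_sub, map_smul] at h'
    by_cases hp : inducedCon I p q
    · by_cases hr : inducedCon I r q
      · exact (inducedCon I).trans hp ((inducedCon I).symm hr)
      · rw [restrict_monomial_of_notMem (S := {p | ¬ inducedCon I p q}) (not_not.2 hp),
          restrict_monomial_of_mem (S := {p | ¬ inducedCon I p q}) hr, zero_sub,
          neg_mem_iff, smul_mem_iff_mem hl] at h'
        exact absurd (hnil _ h') hr
    · by_cases hr : inducedCon I r q
      · rw [restrict_monomial_of_notMem (S := {p | ¬ inducedCon I p q}) (not_not.2 hr),
          restrict_monomial_of_mem (S := {p | ¬ inducedCon I p q}) hp, smul_zero,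
          sub_zero] at h'
        exact absurd (hnil _ h') hp
      · rw [restrict_monomial_of_mem (S := {p | ¬ inducedCon I p q}) hr,
          restrict_monomial_of_mem (S := {p | ¬ inducedCon I p q}) hp] at h'
        exact ⟨l, hl, h'⟩
  · rintro ⟨l, hl, h⟩
    exact ⟨l, hl, Ideal.mem_sup_left h⟩

/-- A binomial ideal that is maximal for its congruence contains all nil monomials, unless the
quotient monoid is trivial. -/
lemma IsMaximalInducing.monomial_mem_of_isNil {I : Ideal (AddMonoidAlgebra k Q)}
    (h : IsMaximalInducing (inducedCon I) I) (hs : ¬ Subsingleton (inducedCon I).Quotient) {q : Q}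
    (hq : IsNil (q : (inducedCon I).Quotient)) : monomial k q ∈ I :=
  h.2 ⟨h.1.1.sup_span_monomial q, h.1.1.sup_span_monomial_ne_top hq hs,
    h.1.1.inducedCon_sup_span_monomial hq⟩ le_sup_left
    (Ideal.mem_sup_right (Ideal.subset_span rfl))

lemma isNilpotent_mk_monomial_iff {I : Ideal (AddMonoidAlgebra k Q)} {q : Q} :
    IsNilpotent (Ideal.Quotient.mk I (monomial k q)) ↔ ∃ n : ℕ, monomial k (n • q) ∈ I := by
  refine exists_congr fun n => ?_
  rw [← map_pow, Ideal.Quotient.eq_zero_iff_mem, monomial_nsmul]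

lemma isCellularIdeal_of_isPrimaryCon {I : Ideal (AddMonoidAlgebra k Q)}
    (h : IsMaximalInducing (inducedCon I) I) (hc : IsPrimaryCon (inducedCon I)) :
    IsCellularIdeal I := by
  refine ⟨h.1.2.1, fun q => ?_⟩
  rw [← h.1.1.isCancellative_iff]
  by_cases hs : Subsingleton (inducedCon I).Quotient
  · exact Or.inl fun a b _ => Subsingleton.elim _ _
  · refine (hc q).symm.imp_right ?_
    rintro ⟨n, hn⟩
    exact isNilpotent_mk_monomial_iff.2 ⟨n, h.monomial_mem_of_isNil hs hn⟩

lemma IsCellularIdeal.isPrimaryCon {I : Ideal (AddMonoidAlgebra k Q)} (hI : IsBinomialIdeal I)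
    (h : IsCellularIdeal I) : IsPrimaryCon (inducedCon I) := by
  intro x
  induction x using AddCon.induction_on with
  | H q =>
    refine (h.2 q).symm.imp ?_ hI.isCancellative_iff.2
    rintro hq
    obtain ⟨n, hn⟩ := isNilpotent_mk_monomial_iff.1 hq
    exact ⟨n, isNil_of_monomial_mem hn⟩

/-- A larger `J` with the same congruence has no new monomials: a monomial of `J` is nil, hence
nilpotent modulo `I`, and some positive power of it both lies in `I` and belongs to its own class. A
binomial of `J` with nonzero coefficient has a companion in `I` with the same exponents; if the
coefficients differ, the monomials lie in `J` and therefore in `I`. -/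
lemma IsCellularIdeal.isMaximalInducing {I : Ideal (AddMonoidAlgebra k Q)}
    (hI : IsBinomialIdeal I) (h : IsCellularIdeal I) : IsMaximalInducing (inducedCon I) I := by
  refine ⟨⟨hI, h.1, rfl⟩, ?_⟩
  rintro J ⟨hJ, hJtop, hcon⟩ hIJ
  have hmon : ∀ q, monomial k q ∈ J → monomial k q ∈ I := by
    intro q hq
    have hnil : IsNil (q : (inducedCon I).Quotient) := hcon ▸ isNil_of_monomial_mem hq
    rcases h.2 q with hq' | hq'
    -- Nil and cancellative together make the quotient monoid trivial, so `q ∼ 0` and `1 ∈ J`.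
    · exfalso
      have hs := (hI.isCancellative_iff.2 hq').subsingleton_of_isNil hnil
      have h0 : inducedCon I q 0 := (AddCon.eq _).1 (Subsingleton.elim _ _)
      rw [← hcon] at h0
      have := monomial_mem_of_inducedCon h0 hq
      rw [monomial_zero, ← Ideal.eq_top_iff_one] at this
      exact hJtop this
    · obtain ⟨n, hn⟩ := isNilpotent_mk_monomial_iff.1 hq'
      cases n with
      | zero =>
        rw [zero_nsmul, monomial_zero, ← Ideal.eq_top_iff_one] at hn
        exact absurd hn h.1
      | succ n =>
        rw [succ_nsmul] at hn
        exact monomial_mem_of_inducedCon (isNil_coe_iff.1 hnil _) hn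
  obtain ⟨B, hB, hJB⟩ := hJ
  rw [hJB, Ideal.span_le]
  intro f hf
  have hfJ : f ∈ J := by rw [hJB]; exact Ideal.subset_span hf
  obtain ⟨p, q, l, rfl⟩ := hB f hf
  by_cases hl : l = 0
  · subst hl
    rw [zero_smul, sub_zero] at hfJ ⊢
    exact hmon p hfJ
  · have hpq : inducedCon I p q := hcon ▸ ⟨l, hl, hfJ⟩
    obtain ⟨m, hm, hpq⟩ := hpq
    by_cases hlm : m = l
    · exact hlm ▸ hpq
    · have h1 : (m - l) • monomial k q ∈ J := by
        convert J.sub_mem hfJ (hIJ hpq) using 1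
        module
      rw [smul_mem_iff_mem (sub_ne_zero.2 hlm)] at h1
      have h2 := I.add_mem hpq (Submodule.smul_of_tower_mem I (m - l) (hmon q h1))
      simp only [SetLike.mem_coe]
      convert h2 using 1
      module

/-- A binomial ideal is cellular precisely if its congruence is primary and it is maximal for its
congruence. -/
theorem isCellularIdeal_iff {I : Ideal (AddMonoidAlgebra k Q)} (hI : IsBinomialIdeal I) :
    IsCellularIdeal I ↔ IsPrimaryCon (inducedCon I) ∧ IsMaximalInducing (inducedCon I) I :=
  ⟨fun h => ⟨h.isPrimaryCon hI, h.isMaximalInducing hI⟩,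
    fun h => isCellularIdeal_of_isPrimaryCon h.2 h.1⟩

theorem isMesoprimaryIdeal_iff (I : Ideal (AddMonoidAlgebra k Q)) :
    IsMesoprimaryIdeal I ↔
      IsMesoprimaryCon (inducedCon I) ∧ IsMaximalInducing (inducedCon I) I := by
  refine ⟨?_, fun h => ⟨_, h⟩⟩
  rintro ⟨c, hc, hI⟩
  obtain rfl := hI.1.2.2
  exact ⟨hc, hI⟩

end Cellular

/-! ### Extending homomorphisms into a divisible group of units -/

section Divisible

/-- Homomorphisms to the units of an algebraically closed field extend along injections of
commutative groups. -/
lemma exists_monoidHom_comp_eq {K A B : Type*} [Field K] [IsAlgClosed K] [CommGroup A]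
    [CommGroup B] (i : A →* B) (hi : Function.Injective i) (g : A →* Kˣ) :
    ∃ h : B →* Kˣ, h.comp i = g := by
  have hsurj : ∀ {n : ℕ}, n ≠ 0 → Function.Surjective fun a : Additive Kˣ => n • a := by
    intro n hn a
    obtain ⟨z, hz⟩ := IsAlgClosed.exists_pow_nat_eq ((a.toMul : Kˣ) : K) (Nat.pos_of_ne_zero hn)
    have hz0 : z ≠ 0 := by
      rintro rfl
      rw [zero_pow hn] at hz
      exact a.toMul.ne_zero hz.symm
    refine ⟨Additive.ofMul (Units.mk0 z hz0), ?_⟩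
    refine Additive.toMul.injective (Units.ext ?_)
    simpa using hz
  let _ : DivisibleBy (Additive Kˣ) ℕ := divisibleByOfSMulRightSurj _ _ hsurj
  let _ : DivisibleBy (Additive Kˣ) ℤ := AddGroup.divisibleByIntOfDivisibleByNat _
  obtain ⟨h, hh⟩ := (Module.Baer.of_divisible (Additive Kˣ)).extension_property_addMonoidHom
    i.toAdditive hi g.toAdditive
  refine ⟨MonoidHom.toAdditive.symm h, ?_⟩
  ext a
  exact congrArg (fun x : Additive Kˣ => ((x.toMul : Kˣ) : K))
    (DFunLike.congr_fun hh (Additive.ofMul a))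

end Divisible

/-! ### Characters and the map to the group algebra of differences -/

section Character

variable {k : Type v} [Field k] {Q : Type u} [AddCommMonoid Q]

/-- A multiplicative function on exponents, compatible with the binomials in an ideal and
supported on the exponents that are cancellative modulo the ideal. -/
structure Character (I : Ideal (AddMonoidAlgebra k Q)) (K : Type*) [Field K] [Algebra k K] where
  /-- The underlying multiplicative function. -/
  hom : Multiplicative Q →* K
  ne_zero_iff : ∀ q : Q, hom (.ofAdd q) ≠ 0 ↔ IsCancellative (q : (inducedCon I).Quotient)
  eq_of_mem : ∀ (p q : Q) (l : k), l ≠ 0 → monomial k p - l • monomial k q ∈ I →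
    hom (.ofAdd p) = algebraMap k K l * hom (.ofAdd q)

/-- `L` is the total ring of fractions of `k[Q]/I`, where the monomials that become units are
exactly the cancellative ones. Divisibility of `Kˣ` extends `kˣ → Kˣ` to `Lˣ`; since the extension
agrees with the inclusion on `kˣ`, relations between monomials are respected. -/
lemma IsBinomialIdeal.nonempty_character {I : Ideal (AddMonoidAlgebra k Q)}
    (hI : IsBinomialIdeal I) (htop : I ≠ ⊤) (K : Type*) [Field K] [Algebra k K] [IsAlgClosed K] :
    Nonempty (Character I K) := by
  classical
  have : Nontrivial (AddMonoidAlgebra k Q ⧸ I) := Ideal.Quotient.nontrivial_iff.2 htop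
  let A := AddMonoidAlgebra k Q ⧸ I
  let L := FractionRing A
  have hinj : Function.Injective (algebraMap A L) := IsFractionRing.injective A L
  have : Nontrivial L := hinj.nontrivial
  let j : k →+* L := (algebraMap A L).comp (algebraMap k A)
  obtain ⟨h, hh⟩ := exists_monoidHom_comp_eq (Units.map (j : k →* L))
    (Units.map_injective j.injective) (Units.map (algebraMap k K : k →* K))
  -- `X` is `h` extended by zero, so its nonvanishing detects units.
  let X : MulChar L K := MulChar.ofUnitHom h
  have hX : ∀ x : L, X x ≠ 0 ↔ IsUnit x := by
    intro x
    refine ⟨fun hx => by_contra fun hx' => hx (X.map_nonunit hx'), ?_⟩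
    rintro ⟨x, rfl⟩
    rw [MulChar.ofUnitHom_coe]
    exact Units.ne_zero _
  let m : Multiplicative Q →* L :=
    ((algebraMap A L).comp (Ideal.Quotient.mk I) : AddMonoidAlgebra k Q →* L).comp
      (AddMonoidAlgebra.of k Q)
  have hm : ∀ q, m (.ofAdd q) = algebraMap A L (Ideal.Quotient.mk I (monomial k q)) :=
    fun q => rfl
  refine ⟨⟨(X : L →* K).comp m, fun q => ?_, fun p q l hl hpq => ?_⟩⟩
  · rw [hI.isCancellative_iff]
    refine (hX _).trans ?_
    rw [hm]
    refine ⟨fun hu => ?_, fun hu => IsLocalization.map_units L (⟨_, hu⟩ : nonZeroDivisors A)⟩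
    rw [mem_nonZeroDivisors_iff_left]
    intro y hy
    refine hinj ?_
    have := congrArg (algebraMap A L) hy
    rw [map_mul, map_zero] at this
    rw [map_zero]
    exact (hu.mul_right_eq_zero).1 this
  · have h1 : m (.ofAdd p) = j l * m (.ofAdd q) := by
      have h2 : Ideal.Quotient.mk I (monomial k p) =
          algebraMap k A l * Ideal.Quotient.mk I (monomial k q) := by
        rw [← sub_eq_zero, ← Algebra.smul_def]
        exact Ideal.Quotient.eq_zero_iff_mem.2 hpq
      rw [hm, h2, map_mul, hm]
      rfl
    change X (m _) = _ * X (m _)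
    rw [h1, map_mul]
    congr 1
    have h3 := DFunLike.congr_fun hh (Units.mk0 l hl)
    have h4 : X ((Units.map (j : k →* L) (Units.mk0 l hl) : Lˣ) : L) =
      (h (Units.map (j : k →* L) (Units.mk0 l hl)) : Kˣ) := MulChar.ofUnitHom_coe _ _
    exact h4.trans (congrArg Units.val h3)

variable (Q) in
/-- The submonoid of cancellative elements. -/
def cancellatives : AddSubmonoid Q where
  carrier := {x | IsCancellative x}
  zero_mem' := isCancellative_zero
  add_mem' ha hb := isCancellative_add_iff.2 ⟨ha, hb⟩

lemma mem_cancellatives {x : Q} : x ∈ cancellatives Q ↔ IsCancellative x := Iff.rfl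

instance : IsCancelAdd (cancellatives Q) :=
  have : IsLeftCancelAdd (cancellatives Q) :=
    ⟨fun a _ _ h => Subtype.ext (a.2 _ _ (congrArg Subtype.val h))⟩
  AddCommMagma.IsLeftCancelAdd.toIsCancelAdd _

/-- A sum is cancellative only if both summands are, so the cancellative generators suffice. -/
instance [AddMonoid.FG Q] : AddMonoid.FG (cancellatives Q) := by
  rw [AddMonoid.fg_iff_addSubmonoid_fg]
  obtain ⟨S, hS⟩ := AddMonoid.fg_def.1 ‹AddMonoid.FG Q›
  classical
  refine ⟨S.filter (· ∈ cancellatives Q), le_antisymm ?_ ?_⟩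
  · rw [AddSubmonoid.closure_le]
    intro x hx
    exact (Finset.mem_filter.1 hx).2
  · intro x hx
    have hx' : x ∈ AddSubmonoid.closure (S : Set Q) := hS ▸ trivial
    induction hx' using AddSubmonoid.closure_induction with
    | mem x h => exact AddSubmonoid.subset_closure (Finset.mem_filter.2 ⟨h, hx⟩)
    | zero => exact zero_mem _
    | add x y _ _ ihx ihy =>
      obtain ⟨h1, h2⟩ := isCancellative_add_iff.1 hx
      exact add_mem (ihx h1) (ihy h2)

instance (c : AddCon Q) [AddMonoid.FG Q] : AddMonoid.FG c.Quotient :=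
  AddMonoid.fg_of_surjective c.mk' AddCon.mk'_surjective

/-- The group of differences of cancellative elements of the quotient by the congruence of an
ideal. -/
abbrev DifferenceGroup (I : Ideal (AddMonoidAlgebra k Q)) : Type u :=
  Algebra.GrothendieckAddGroup (cancellatives (inducedCon I).Quotient)

open Classical in
/-- The degree of an exponent in the group of differences, with the junk value `0` for exponents
that are not cancellative. -/
noncomputable def degree (I : Ideal (AddMonoidAlgebra k Q)) (q : Q) : DifferenceGroup I :=
  if h : IsCancellative (q : (inducedCon I).Quotient) then
    Algebra.GrothendieckAddGroup.of ⟨q, mem_cancellatives.2 h⟩ else 0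

lemma degree_of_isCancellative {I : Ideal (AddMonoidAlgebra k Q)} {q : Q}
    (h : IsCancellative (q : (inducedCon I).Quotient)) : degree I q =
      Algebra.GrothendieckAddGroup.of
        (⟨q, mem_cancellatives.2 h⟩ : cancellatives (inducedCon I).Quotient) :=
  dif_pos h

lemma degree_add {I : Ideal (AddMonoidAlgebra k Q)} {p q : Q}
    (hp : IsCancellative (p : (inducedCon I).Quotient))
    (hq : IsCancellative (q : (inducedCon I).Quotient)) :
    degree I (p + q) = degree I p + degree I q := by
  have hpq : IsCancellative ((p + q : Q) : (inducedCon I).Quotient) :=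
    isCancellative_add_iff.2 ⟨hp, hq⟩
  rw [degree_of_isCancellative hp, degree_of_isCancellative hq, degree_of_isCancellative hpq,
    ← map_add]
  rfl

lemma degree_zero (I : Ideal (AddMonoidAlgebra k Q)) : degree I 0 = 0 := by
  have h : IsCancellative ((0 : Q) : (inducedCon I).Quotient) := isCancellative_zero
  rw [degree_of_isCancellative h]
  exact map_zero _

lemma degree_eq_iff {I : Ideal (AddMonoidAlgebra k Q)} {p q : Q}
    (hp : IsCancellative (p : (inducedCon I).Quotient))
    (hq : IsCancellative (q : (inducedCon I).Quotient)) :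
    degree I p = degree I q ↔ inducedCon I p q := by
  rw [degree_of_isCancellative hp, degree_of_isCancellative hq,
    Algebra.GrothendieckAddGroup.of_injective.eq_iff, Subtype.mk_eq_mk, AddCon.eq]

namespace Character

variable {I : Ideal (AddMonoidAlgebra k Q)} {K : Type*} [Field K] [Algebra k K]
  (χ : Character I K)

lemma map_add (p q : Q) : χ.hom (.ofAdd (p + q)) = χ.hom (.ofAdd p) * χ.hom (.ofAdd q) := by
  rw [ofAdd_add, _root_.map_mul]

lemma eq_zero {q : Q} (h : ¬ IsCancellative (q : (inducedCon I).Quotient)) :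
    χ.hom (.ofAdd q) = 0 := by
  rwa [← χ.ne_zero_iff, not_not] at h

/-- The homomorphism to the group algebra of the group of differences determined by a
character. -/
noncomputable def toGroupAlgebra :
    AddMonoidAlgebra k Q →ₐ[k] AddMonoidAlgebra K (DifferenceGroup I) :=
  AddMonoidAlgebra.lift k _ Q
    { toFun := fun q => AddMonoidAlgebra.single (degree I q.toAdd) (χ.hom q)
      map_one' := by
        rw [χ.hom.map_one, toAdd_one, degree_zero]
        rfl
      map_mul' := by
        intro p q
        rw [χ.hom.map_mul, toAdd_mul, AddMonoidAlgebra.single_mul_single]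
        by_cases h : χ.hom p * χ.hom q = 0
        · simp [h]
        · rw [degree_add ((χ.ne_zero_iff p.toAdd).1 (left_ne_zero_of_mul h))
            ((χ.ne_zero_iff q.toAdd).1 (right_ne_zero_of_mul h))] }

lemma toGroupAlgebra_monomial (q : Q) : χ.toGroupAlgebra (monomial k q) =
    AddMonoidAlgebra.single (degree I q) (χ.hom (.ofAdd q)) := by
  rw [toGroupAlgebra, monomial, AddMonoidAlgebra.lift_single, one_smul]
  rfl

lemma not_isCancellative_of_mem (htop : I ≠ ⊤) {q : Q} (hq : monomial k q ∈ I) :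
    ¬ IsCancellative (q : (inducedCon I).Quotient) := by
  intro hc
  have hs := hc.subsingleton_of_isNil (isNil_of_monomial_mem hq)
  have := monomial_mem_of_inducedCon (q := 0) ((AddCon.eq _).1 (hs.elim _ _)) hq
  rw [monomial_zero, ← Ideal.eq_top_iff_one] at this
  exact htop this

lemma le_ker (hI : IsBinomialIdeal I) (htop : I ≠ ⊤) :
    I ≤ RingHom.ker χ.toGroupAlgebra := by
  obtain ⟨B, hB, hIB⟩ := id hI
  conv_lhs => rw [hIB]
  rw [Ideal.span_le]
  intro f hf
  have hfI : f ∈ I := by rw [hIB]; exact Ideal.subset_span hf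
  obtain ⟨p, q, l, rfl⟩ := hB f hf
  rw [SetLike.mem_coe, RingHom.mem_ker, map_sub, map_smul, toGroupAlgebra_monomial,
    toGroupAlgebra_monomial]
  by_cases hl : l = 0
  · subst hl
    rw [zero_smul, sub_zero] at hfI ⊢
    rw [χ.eq_zero (not_isCancellative_of_mem htop hfI), AddMonoidAlgebra.single_zero]
  · rw [χ.eq_of_mem p q l hl hfI, AddMonoidAlgebra.smul_single, Algebra.smul_def, sub_eq_zero]
    by_cases hq : IsCancellative (q : (inducedCon I).Quotient)
    · have hpq : inducedCon I p q := ⟨l, hl, hfI⟩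
      have hp : IsCancellative (p : (inducedCon I).Quotient) := by
        rwa [(AddCon.eq _).2 hpq]
      rw [(degree_eq_iff hp hq).2 hpq]
    · simp [χ.eq_zero hq]

/-- Distinct cancellative classes have distinct degrees, and all other exponents map to zero, so
only the class of `p` contributes. -/
lemma coeff_toGroupAlgebra {p : Q} (hp : IsCancellative (p : (inducedCon I).Quotient))
    (f : AddMonoidAlgebra k Q) : (χ.toGroupAlgebra f).coeff (degree I p) =
      (χ.toGroupAlgebra (restrict {q | inducedCon I q p} f)).coeff (degree I p) := by
  induction f using monomial_induction with
  | zero => simp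
  | add f g hf hg =>
    simp only [_root_.map_add, AddMonoidAlgebra.coeff_add, Finsupp.add_apply, hf, hg]
  | smul r q =>
    by_cases h : inducedCon I q p
    · rw [map_smul (restrict _), restrict_monomial_of_mem (S := {q | inducedCon I q p}) h]
    · rw [map_smul (restrict _),
        restrict_monomial_of_notMem (S := {q | inducedCon I q p}) h, smul_zero, map_smul,
        toGroupAlgebra_monomial]
      by_cases hq : IsCancellative (q : (inducedCon I).Quotient)
      · have hne : degree I q ≠ degree I p := mt (degree_eq_iff hq hp).1 h
        simp [hne]
      · simp [χ.eq_zero hq]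

/-- The kernel of the homomorphism determined by a character consists of the elements whose
cancellative part lies in the ideal. -/
lemma mem_ker_iff (hI : IsBinomialIdeal I) (htop : I ≠ ⊤) {f : AddMonoidAlgebra k Q} :
    f ∈ RingHom.ker χ.toGroupAlgebra ↔
      restrict {q : Q | IsCancellative (q : (inducedCon I).Quotient)} f ∈ I := by
  constructor
  · intro hf
    refine mem_of_forall_restrict_class_mem fun p => ?_
    rw [restrict_restrict]
    by_cases hp : IsCancellative (p : (inducedCon I).Quotient)
    · have hS : {q | inducedCon I q p} ∩ {q : Q | IsCancellative (q : (inducedCon I).Quotient)} =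
          {q | inducedCon I q p} := by
        refine Set.inter_eq_left.2 fun q hq => ?_
        have : (q : (inducedCon I).Quotient) = p := (AddCon.eq _).2 hq
        simpa [this] using hp
      rw [hS]
      obtain ⟨l, hl⟩ := exists_restrict_class_sub_mem I p f
      have h1 := χ.coeff_toGroupAlgebra hp f
      have h2 := χ.le_ker hI htop hl
      rw [RingHom.mem_ker] at hf h2
      rw [map_sub, sub_eq_zero] at h2
      rw [hf, h2, map_smul, toGroupAlgebra_monomial] at h1
      have h3 : l • χ.hom (.ofAdd p) = 0 := by simpa using h1.symm
      have h4 : l = 0 := by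
        rw [smul_eq_zero] at h3
        exact h3.resolve_right ((χ.ne_zero_iff p).2 hp)
      simpa [h4] using hl
    · have hS : {q | inducedCon I q p} ∩ {q : Q | IsCancellative (q : (inducedCon I).Quotient)} =
          ∅ := by
        refine Set.eq_empty_of_forall_notMem fun q ⟨hq, hq'⟩ => hp ?_
        have : (q : (inducedCon I).Quotient) = p := (AddCon.eq _).2 hq
        rw [← this]; exact hq'
      rw [hS]
      convert I.zero_mem
      ext q
      exact coeff_restrict_of_notMem (Set.notMem_empty q) f
  · intro h
    have h1 := χ.le_ker hI htop h
    rw [← restrict_compl_add {q : Q | IsCancellative (q : (inducedCon I).Quotient)} f]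
    refine Ideal.add_mem _ h1 ?_
    refine restrict_induction (motive := fun f => f ∈ RingHom.ker χ.toGroupAlgebra) _ f
      (Ideal.zero_mem _) (fun f g => Ideal.add_mem _) ?_
    intro r q hq
    rw [RingHom.mem_ker, map_smul, toGroupAlgebra_monomial, χ.eq_zero hq]
    simp

end Character

end Character

/-! ### Homogeneous elements of twisted group algebras -/

section Homogeneous

variable {k : Type v} [Field k] {G : Type*} [AddCommGroup G] {R : Type*} [CommRing R]
  [Algebra k R] {𝒜 : G → Submodule k R}

lemma IsTwistedGroupAlgebra.nontrivial (h : IsTwistedGroupAlgebra 𝒜) : Nontrivial R := by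
  obtain ⟨-, e, -⟩ := h
  by_contra hR
  rw [not_nontrivial_iff_subsingleton] at hR
  have h : (1 : AlgebraicClosure k ⊗[k] R) = 0 := by
    rw [Algebra.TensorProduct.one_def, Subsingleton.elim (1 : R) 0, TensorProduct.tmul_zero]
  have h' := congrArg e h
  rw [map_one, map_zero] at h'
  exact one_ne_zero h'

/-- Nonzero homogeneous elements of twisted group algebras are nonzerodivisors. -/
lemma IsTwistedGroupAlgebra.eq_zero_of_mul_eq_zero (h : IsTwistedGroupAlgebra 𝒜) {g : G} {r x : R}
    (hr : r ∈ 𝒜 g) (hr0 : r ≠ 0) (hx : r * x = 0) : x = 0 := by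
  obtain ⟨-, e, he⟩ := h
  let ι : R →ₐ[k] AlgebraicClosure k ⊗[k] R := Algebra.TensorProduct.includeRight
  have hι : Function.Injective (e ∘ ι) := e.injective.comp
    (Algebra.TensorProduct.includeRight_injective (algebraMap k (AlgebraicClosure k)).injective)
  have h1 : e (ι r) ∈ AddMonoidAlgebra.grade (AlgebraicClosure k) g := by
    rw [← he g]
    exact ⟨ι r, Submodule.tmul_mem_baseChange_of_mem 1 hr, rfl⟩
  rw [AddMonoidAlgebra.mem_grade_iff'] at h1
  obtain ⟨a, ha⟩ := h1
  rw [AddMonoidAlgebra.lsingle_apply] at ha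
  have ha0 : a ≠ 0 := by
    rintro rfl
    refine hr0 (hι ?_)
    rw [Function.comp_apply, Function.comp_apply, ← ha]
    simp
  refine hι ?_
  have h2 : e (ι r) * e (ι x) = 0 := by rw [← map_mul, ← map_mul, hx, map_zero, map_zero]
  rw [← ha] at h2
  -- Over the closure, `r` becomes a nonzero scalar times a group element, which is invertible.
  have h3 := congrArg (AddMonoidAlgebra.single (-g) a⁻¹ * ·) h2
  simp only [← mul_assoc, AddMonoidAlgebra.single_mul_single, neg_add_cancel,
    inv_mul_cancel₀ ha0, mul_zero, ← AddMonoidAlgebra.one_def, one_mul] at h3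
  simpa using h3

end Homogeneous

/-! ### Mesoprime ideals are cellular with prime congruence -/

section Mesoprime

variable {k : Type v} [Field k] {Q : Type u} [AddCommMonoid Q]

lemma IsMesoprimeIdeal.isPrimeCon_and_isCellularIdeal {I : Ideal (AddMonoidAlgebra k Q)}
    (h : IsMesoprimeIdeal I) : IsPrimeCon (inducedCon I) ∧ IsCellularIdeal I := by
  obtain ⟨G, _, R, _, _, 𝒜, φ, hR, hφ, rfl⟩ := h
  have := hR.nontrivial
  have key : ∀ q : Q, φ (monomial k q) ≠ 0 →
      ∀ f, monomial k q * f ∈ RingHom.ker φ → f ∈ RingHom.ker φ := by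
    intro q hq f hf
    obtain ⟨g, hg⟩ := hφ q
    rw [RingHom.mem_ker, map_mul] at hf
    exact hR.eq_zero_of_mul_eq_zero hg hq hf
  refine ⟨fun x => ?_, RingHom.ker_ne_top φ, fun q => ?_⟩
  · induction x using AddCon.induction_on with
    | H q =>
      by_cases hq : φ (monomial k q) = 0
      · exact Or.inl (isNil_of_monomial_mem hq)
      · exact Or.inr (isCancellative_of_forall_mem (key q hq))
  · by_cases hq : φ (monomial k q) = 0
    · exact Or.inr (isNilpotent_mk_monomial_iff.2 ⟨1, by rwa [one_nsmul]⟩)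
    · exact Or.inl (mk_mem_nonZeroDivisors_iff.2 (key q hq))

end Mesoprime

/-! ### Construction of twisted group algebras -/

section Twist

variable (k : Type v) [Field k] {K : Type*} [Field K] [Algebra k K] {G : Type*}

lemma linearIndependent_single {u : G → K} (hu : ∀ g, u g ≠ 0) :
    LinearIndependent k fun g => AddMonoidAlgebra.single g (u g) := by
  classical
  rw [linearIndependent_iff']
  intro s c hc g hg
  have h := congrArg (fun f : AddMonoidAlgebra K G => f.coeff g) hc
  simp only [AddMonoidAlgebra.coeff_sum, Finsupp.finsetSum_apply, AddMonoidAlgebra.coeff_smul,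
    AddMonoidAlgebra.coeff_single, Finsupp.smul_apply, Finsupp.single_apply,
    AddMonoidAlgebra.coeff_zero, Finsupp.coe_zero, Pi.zero_apply, smul_ite, smul_zero,
    Finset.sum_ite_eq', if_pos hg] at h
  exact (smul_eq_zero.1 h).resolve_right (hu g)

variable {k} [AddCommGroup G]

/-- A function on an abelian group with values in an extension field which is multiplicative up to
scalars. -/
structure IsScalarMultiplicative (k : Type*) [Field k] {K : Type*} [Field K] [Algebra k K]
    {G : Type*} [AddCommGroup G] (u : G → K) : Prop where
  ne_zero : ∀ g, u g ≠ 0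
  zero : ∃ c : k, 1 = algebraMap k K c * u 0
  add : ∀ g h, ∃ c : k, u g * u h = algebraMap k K c * u (g + h)

/-- The twisted group algebra spanned by scaled monomials. -/
noncomputable def twistedSubalgebra {u : G → K} (hu : IsScalarMultiplicative k u) :
    Subalgebra k (AddMonoidAlgebra K G) :=
  (Submodule.span k (Set.range fun g => AddMonoidAlgebra.single g (u g))).toSubalgebra
    (by
      obtain ⟨c, hc⟩ := hu.zero
      have h : (1 : AddMonoidAlgebra K G) = c • AddMonoidAlgebra.single 0 (u 0) := by
        rw [AddMonoidAlgebra.smul_single, Algebra.smul_def, ← hc]; rfl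
      rw [h]
      exact Submodule.smul_mem _ _ (Submodule.subset_span ⟨0, rfl⟩))
    (by
      intro x y hx hy
      induction hx, hy using Submodule.span_induction₂ with
      | mem_mem x y hx hy =>
        obtain ⟨g, rfl⟩ := hx
        obtain ⟨h, rfl⟩ := hy
        obtain ⟨c, hc⟩ := hu.add g h
        dsimp only
        rw [AddMonoidAlgebra.single_mul_single, hc, ← Algebra.smul_def,
          ← AddMonoidAlgebra.smul_single]
        exact Submodule.smul_mem _ _ (Submodule.subset_span ⟨g + h, rfl⟩)
      | zero_left y hy => rw [zero_mul]; exact Submodule.zero_mem _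
      | zero_right x hx => rw [mul_zero]; exact Submodule.zero_mem _
      | add_left x y z _ _ _ h1 h2 => rw [add_mul]; exact Submodule.add_mem _ h1 h2
      | add_right x y z _ _ _ h1 h2 => rw [mul_add]; exact Submodule.add_mem _ h1 h2
      | smul_left r x y _ _ h => rw [smul_mul_assoc]; exact Submodule.smul_mem _ _ h
      | smul_right r x y _ _ h => rw [mul_smul_comm]; exact Submodule.smul_mem _ _ h)

variable {u : G → K} (hu : IsScalarMultiplicative k u)

/-- The basis of a twisted group algebra consisting of scaled monomials. -/
noncomputable def twistedBasis : Module.Basis G k (twistedSubalgebra hu) :=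
  Module.Basis.span (linearIndependent_single k hu.ne_zero)

lemma coe_twistedBasis (g : G) :
    (twistedBasis hu g : AddMonoidAlgebra K G) = AddMonoidAlgebra.single g (u g) :=
  congrArg Subtype.val (Module.Basis.span_apply (linearIndependent_single k hu.ne_zero) g)

/-- The homogeneous pieces of a twisted group algebra. -/
noncomputable def twistedGrade (g : G) : Submodule k (twistedSubalgebra hu) :=
  Submodule.span k {twistedBasis hu g}

lemma mem_twistedGrade_of_eq {g : G} {x : twistedSubalgebra hu} {c : k}
    (h : (x : AddMonoidAlgebra K G) = AddMonoidAlgebra.single g (algebraMap k K c * u g)) :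
    x ∈ twistedGrade hu g := by
  refine Submodule.mem_span_singleton.2 ⟨c, Subtype.ext ?_⟩
  rw [h, ← Algebra.smul_def, ← AddMonoidAlgebra.smul_single, ← coe_twistedBasis hu]
  rfl

lemma exists_eq_of_mem_twistedGrade {g : G} {x : twistedSubalgebra hu}
    (h : x ∈ twistedGrade hu g) :
    ∃ c : k, (x : AddMonoidAlgebra K G) = AddMonoidAlgebra.single g (algebraMap k K c * u g) := by
  obtain ⟨c, rfl⟩ := Submodule.mem_span_singleton.1 h
  refine ⟨c, ?_⟩
  rw [← Algebra.smul_def, ← AddMonoidAlgebra.smul_single, ← coe_twistedBasis hu]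
  rfl

lemma twistedGrade_gradedMonoid : SetLike.GradedMonoid (twistedGrade hu) where
  one_mem := by
    obtain ⟨c, hc⟩ := hu.zero
    exact mem_twistedGrade_of_eq hu (c := c) (by rw [← hc]; rfl)
  mul_mem := by
    intro g h x y hx hy
    obtain ⟨a, ha⟩ := exists_eq_of_mem_twistedGrade hu hx
    obtain ⟨b, hb⟩ := exists_eq_of_mem_twistedGrade hu hy
    obtain ⟨c, hc⟩ := hu.add g h
    refine mem_twistedGrade_of_eq hu (c := a * b * c) ?_
    rw [Subalgebra.coe_mul, ha, hb, AddMonoidAlgebra.single_mul_single, mul_mul_mul_comm, hc,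
      map_mul, map_mul, mul_assoc, mul_assoc, mul_assoc]

lemma twistedGrade_isInternal [DecidableEq G] : DirectSum.IsInternal (twistedGrade hu) := by
  refine DirectSum.isInternal_submodule_of_iSupIndep_of_iSup_eq_top
    (twistedBasis hu).linearIndependent.iSupIndep_span_singleton ?_
  rw [← (twistedBasis hu).span_eq, Submodule.span_range_eq_iSup]
  rfl

/-- The group algebra over the extension field is obtained from a twisted group algebra by
extension of scalars. -/
noncomputable def twistedBaseChange :
    (K ⊗[k] twistedSubalgebra hu) →ₐ[K] AddMonoidAlgebra K G :=
  Algebra.TensorProduct.lift (Algebra.ofId K _) (twistedSubalgebra hu).val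
    fun _ _ => Commute.all _ _

lemma twistedBaseChange_basis (g : G) :
    twistedBaseChange hu (1 ⊗ₜ twistedBasis hu g) = AddMonoidAlgebra.single g (u g) := by
  rw [twistedBaseChange, Algebra.TensorProduct.lift_tmul, map_one, one_mul, ← coe_twistedBasis hu]
  rfl

lemma span_single_eq_top (hu : ∀ g, u g ≠ 0) :
    ⊤ ≤ Submodule.span K (Set.range fun g => AddMonoidAlgebra.single g (u g)) := by
  intro f _
  induction f using AddMonoidAlgebra.induction_linear with
  | zero => exact Submodule.zero_mem _
  | add x y hx hy => exact Submodule.add_mem _ (hx trivial) (hy trivial)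
  | single g r =>
    have h : AddMonoidAlgebra.single g r = (r / u g) • AddMonoidAlgebra.single g (u g) := by
      rw [AddMonoidAlgebra.smul_single, smul_eq_mul, div_mul_cancel₀ _ (hu g)]
    rw [h]
    exact Submodule.smul_mem _ _ (Submodule.subset_span ⟨g, rfl⟩)

/-- Every `u g` is invertible in `K`, so the scaled monomials also form a `K`-basis of the group
algebra, and the map matches the two bases. -/
lemma twistedBaseChange_bijective : Function.Bijective (twistedBaseChange hu) := by
  let B := Algebra.TensorProduct.basis K (twistedBasis hu)
  let V : Module.Basis G K (AddMonoidAlgebra K G) :=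
    Module.Basis.mk (linearIndependent_single K hu.ne_zero) (span_single_eq_top hu.ne_zero)
  have h : (twistedBaseChange hu).toLinearMap = (B.equiv V (Equiv.refl G)).toLinearMap := by
    refine B.ext fun g => ?_
    rw [LinearEquiv.coe_coe, Module.Basis.equiv_apply, Equiv.refl_apply, Module.Basis.mk_apply,
      Algebra.TensorProduct.basis_apply]
    exact twistedBaseChange_basis hu g
  have h' : ⇑(twistedBaseChange hu) = B.equiv V (Equiv.refl G) :=
    congrArg (fun f : _ →ₗ[K] _ => ⇑f) h
  rw [h']
  exact (B.equiv V (Equiv.refl G)).bijective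

lemma isTwistedGroupAlgebra_twistedGrade {u : G → AlgebraicClosure k}
    (hu : IsScalarMultiplicative k u) : IsTwistedGroupAlgebra (twistedGrade hu) := by
  classical
  refine ⟨⟨?_⟩, AlgEquiv.ofBijective _ (twistedBaseChange_bijective hu), fun g => ?_⟩
  · exact { twistedGrade_gradedMonoid hu with
      toDecomposition := DirectSum.IsInternal.chooseDecomposition _ (by
        convert twistedGrade_isInternal hu) }
  · rw [twistedGrade, Submodule.baseChange_span, Submodule.map_span, Set.image_singleton,
      Set.image_singleton]
    have h : (AlgEquiv.ofBijective _ (twistedBaseChange_bijective hu)).toLinearMap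
        (((TensorProduct.mk k (AlgebraicClosure k) (twistedSubalgebra hu)) 1) (twistedBasis hu g)) =
        AddMonoidAlgebra.single g (u g) := twistedBaseChange_basis hu g
    rw [h]
    ext f
    rw [AddMonoidAlgebra.mem_grade_iff', Submodule.mem_span_singleton]
    constructor
    · rintro ⟨a, rfl⟩
      exact ⟨a * u g, by rw [AddMonoidAlgebra.lsingle_apply, AddMonoidAlgebra.smul_single]; rfl⟩
    · rintro ⟨a, rfl⟩
      exact ⟨a / u g, by rw [AddMonoidAlgebra.lsingle_apply, AddMonoidAlgebra.smul_single,
        smul_eq_mul, div_mul_cancel₀ _ (hu.ne_zero g)]⟩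

end Twist

/-! ### Ideals maximal for a prime congruence are mesoprime -/

section Mesoprime

variable {k : Type v} [Field k] {Q : Type u} [AddCommMonoid Q]

lemma exists_degree_add_eq (I : Ideal (AddMonoidAlgebra k Q)) (g : DifferenceGroup I) :
    ∃ p q : Q, IsCancellative (p : (inducedCon I).Quotient) ∧
      IsCancellative (q : (inducedCon I).Quotient) ∧ g + degree I q = degree I p := by
  obtain ⟨⟨x, y⟩, h⟩ := (AddLocalization.addMonoidOf
    (⊤ : AddSubmonoid (cancellatives (inducedCon I).Quotient))).surj g
  obtain ⟨⟨x, hx⟩, ⟨⟨y, hy⟩, hy'⟩⟩ := x, y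
  induction x using AddCon.induction_on with
  | H p =>
    induction y using AddCon.induction_on with
    | H q =>
      refine ⟨p, q, hx, hy, ?_⟩
      rw [degree_of_isCancellative hx, degree_of_isCancellative hy]
      exact h

namespace Character

variable {I : Ideal (AddMonoidAlgebra k Q)} {K : Type*} [Field K] [Algebra k K]
  (χ : Character I K)

lemma exists_eq_of_degree_eq {p q : Q} (hp : IsCancellative (p : (inducedCon I).Quotient))
    (hq : IsCancellative (q : (inducedCon I).Quotient)) (h : degree I p = degree I q) :
    ∃ c : k, χ.hom (.ofAdd p) = algebraMap k K c * χ.hom (.ofAdd q) := by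
  obtain ⟨c, hc, h⟩ := (degree_eq_iff hp hq).1 h
  exact ⟨c, χ.eq_of_mem p q c hc h⟩

/-- Extending a character to the group of differences by choosing representatives gives a function
which is multiplicative up to scalars. -/
lemma exists_isScalarMultiplicative : ∃ u : DifferenceGroup I → K, IsScalarMultiplicative k u ∧
    ∀ q : Q, IsCancellative (q : (inducedCon I).Quotient) →
      ∃ c : k, χ.hom (.ofAdd q) = algebraMap k K c * u (degree I q) := by
  choose p q hp hq hpq using exists_degree_add_eq I
  have hp0 := fun g => (χ.ne_zero_iff _).2 (hp g)
  have hq0 := fun g => (χ.ne_zero_iff _).2 (hq g)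
  -- Each `g` is the difference of the degrees of `p g` and `q g`. Another choice of representatives
  -- changes the quotient by a scalar from `k`, which is all that is needed.
  refine ⟨fun g => χ.hom (.ofAdd (p g)) / χ.hom (.ofAdd (q g)), ⟨?_, ?_, ?_⟩, ?_⟩
  · exact fun g => div_ne_zero (hp0 g) (hq0 g)
  · obtain ⟨c, hc⟩ := χ.exists_eq_of_degree_eq (hq 0) (hp 0) (by rw [← hpq 0, zero_add])
    refine ⟨c, ?_⟩
    rw [mul_div_assoc', ← hc, div_self (hq0 0)]
  · intro g h
    have h1 : IsCancellative ((p g + p h + q (g + h) : Q) : (inducedCon I).Quotient) :=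
      isCancellative_add_iff.2 ⟨isCancellative_add_iff.2 ⟨hp g, hp h⟩, hq _⟩
    have h2 : IsCancellative ((q g + q h + p (g + h) : Q) : (inducedCon I).Quotient) :=
      isCancellative_add_iff.2 ⟨isCancellative_add_iff.2 ⟨hq g, hq h⟩, hp _⟩
    obtain ⟨c, hc⟩ := χ.exists_eq_of_degree_eq h1 h2 (by
      rw [degree_add (isCancellative_add_iff.2 ⟨hp g, hp h⟩) (hq _), degree_add (hp g) (hp h),
        degree_add (isCancellative_add_iff.2 ⟨hq g, hq h⟩) (hp _), degree_add (hq g) (hq h),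
        ← hpq g, ← hpq h, ← hpq (g + h)]
      abel)
    refine ⟨c, ?_⟩
    simp only [χ.map_add] at hc
    have := hq0 g
    have := hq0 h
    have := hq0 (g + h)
    field_simp
    linear_combination hc
  · intro r hr
    obtain ⟨c, hc⟩ := χ.exists_eq_of_degree_eq
      (p := r + q (degree I r)) (q := p (degree I r))
      (isCancellative_add_iff.2 ⟨hr, hq _⟩) (hp _) (by rw [degree_add hr (hq _), hpq])
    refine ⟨c, ?_⟩
    rw [χ.map_add] at hc
    rw [mul_div_assoc', ← hc, mul_div_cancel_right₀ _ (hq0 _)]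

/-- The kernel ignores exactly the noncancellative part of an element. For a prime congruence those
exponents are nil, and maximality puts their monomials in `I`. -/
lemma eq_ker_of_isPrimeCon (hc : IsPrimeCon (inducedCon I))
    (h : IsMaximalInducing (inducedCon I) I) : I = RingHom.ker χ.toGroupAlgebra := by
  refine le_antisymm (χ.le_ker h.1.1 h.1.2.1) fun f hf => ?_
  rw [χ.mem_ker_iff h.1.1 h.1.2.1] at hf
  rw [← restrict_compl_add {q : Q | IsCancellative (q : (inducedCon I).Quotient)} f]
  refine I.add_mem hf ?_
  refine restrict_induction (motive := fun f => f ∈ I) _ f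
    I.zero_mem (fun f g => I.add_mem) fun r q hq => ?_
  refine Submodule.smul_of_tower_mem I r (h.monomial_mem_of_isNil ?_ ((hc q).resolve_right hq))
  exact fun hs => hq fun a b _ => hs.elim _ _

end Character

lemma isMesoprimeIdeal_of_isPrimeCon {I : Ideal (AddMonoidAlgebra k Q)}
    (hc : IsPrimeCon (inducedCon I)) (h : IsMaximalInducing (inducedCon I) I) :
    IsMesoprimeIdeal I := by
  have htop : I ≠ ⊤ := h.1.2.1
  obtain ⟨χ⟩ := h.1.1.nonempty_character htop (AlgebraicClosure k)
  obtain ⟨u, hu, hχ⟩ := χ.exists_isScalarMultiplicative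
  have hmon : ∀ q, ∃ c : k, χ.toGroupAlgebra (monomial k q) =
      AddMonoidAlgebra.single (degree I q) (algebraMap k _ c * u (degree I q)) := by
    intro q
    rw [χ.toGroupAlgebra_monomial]
    by_cases hq : IsCancellative (q : (inducedCon I).Quotient)
    · obtain ⟨c, hc⟩ := hχ q hq
      exact ⟨c, by rw [hc]⟩
    · exact ⟨0, by simp [χ.eq_zero hq]⟩
  have hmem : ∀ f, χ.toGroupAlgebra f ∈ twistedSubalgebra hu := by
    intro f
    induction f using monomial_induction with
    | zero => rw [map_zero]; exact zero_mem _
    | add f g hf hg => rw [map_add]; exact add_mem hf hg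
    | smul r q =>
      obtain ⟨c, hc⟩ := hmon q
      rw [map_smul, hc, ← Algebra.smul_def, ← AddMonoidAlgebra.smul_single, ← coe_twistedBasis hu]
      exact Subalgebra.smul_mem _ (Subalgebra.smul_mem _ (Subtype.property _) _) _
  refine ⟨DifferenceGroup I, inferInstance, twistedSubalgebra hu, inferInstance, inferInstance,
    twistedGrade hu, χ.toGroupAlgebra.codRestrict (twistedSubalgebra hu) hmem,
    isTwistedGroupAlgebra_twistedGrade hu, fun q => ⟨degree I q, ?_⟩, ?_⟩
  · obtain ⟨c, hc⟩ := hmon q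
    exact mem_twistedGrade_of_eq hu hc
  · have hker : RingHom.ker (χ.toGroupAlgebra.codRestrict (twistedSubalgebra hu) hmem) =
        RingHom.ker χ.toGroupAlgebra := by
      ext f
      rw [RingHom.mem_ker, RingHom.mem_ker, ← Subtype.coe_inj]
      rfl
    rw [hker]
    exact χ.eq_ker_of_isPrimeCon hc h

/-- A binomial ideal is mesoprime precisely if its congruence is prime and it is maximal for its
congruence. -/
theorem isMesoprimeIdeal_iff {I : Ideal (AddMonoidAlgebra k Q)} (hI : IsBinomialIdeal I) :
    IsMesoprimeIdeal I ↔ IsPrimeCon (inducedCon I) ∧ IsMaximalInducing (inducedCon I) I :=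
  ⟨fun h => ⟨h.isPrimeCon_and_isCellularIdeal.1,
    h.isPrimeCon_and_isCellularIdeal.2.isMaximalInducing hI⟩,
    fun h => isMesoprimeIdeal_of_isPrimeCon h.1 h.2⟩

end Mesoprime

/-! ### Torsion-free cancellative elements form an affine semigroup -/

section Affine

variable {M : Type*} [AddCommMonoid M]

lemma TorsionFreeOn.isAddTorsionFree (h : TorsionFreeOn {x : M | IsCancellative x}) :
    IsAddTorsionFree (cancellatives M) where
  nsmul_right_injective n hn a b hab := Subtype.ext <|
    h a a.2 b b.2 n (Nat.one_le_iff_ne_zero.2 hn) (congrArg Subtype.val hab)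

lemma TorsionFreeOn.isAffineSemigroup [AddMonoid.FG M]
    (h : TorsionFreeOn {x : M | IsCancellative x}) : IsAffineSemigroup (cancellatives M) := by
  have := h.isAddTorsionFree
  let _ : AddCancelCommMonoid (cancellatives M) :=
    { (inferInstance : AddCommMonoid (cancellatives M)) with
      add_left_cancel := fun a b c h => add_left_cancel h }
  let f : cancellatives M →+ (Fin (AffineAddMonoid.dim (cancellatives M)) →₀ ℤ) :=
    (FreeAbelianGroup.equivFinsupp _).toAddMonoidHom.comp
      (AffineAddMonoid.embedding (cancellatives M))
  have hf : Function.Injective f := (FreeAbelianGroup.equivFinsupp _).injective.comp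
    AffineAddMonoid.embedding_injective
  refine ⟨_, AddMonoidHom.mrange f, ?_, ⟨AddEquiv.ofBijective f.mrangeRestrict
    ⟨fun a b hab => hf (congrArg Subtype.val hab), f.mrangeRestrict_surjective⟩⟩⟩
  rw [← AddMonoid.fg_iff_addSubmonoid_fg]
  exact AddMonoid.fg_of_surjective f.mrangeRestrict f.mrangeRestrict_surjective

end Affine

/-! ### Prime ideals and toric congruences -/

section Toric

variable {k : Type v} [Field k] {Q : Type u} [AddCommMonoid Q] {I : Ideal (AddMonoidAlgebra k Q)}

/-- The group of differences inherits torsion-freeness, and the group algebra of a torsion-free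
abelian group over a field is a domain. -/
lemma Character.ker_isPrime [AddMonoid.FG Q] {K : Type*} [Field K] [Algebra k K]
    (χ : Character I K)
    (h : TorsionFreeOn {x : (inducedCon I).Quotient | IsCancellative x}) :
    (RingHom.ker χ.toGroupAlgebra).IsPrime := by
  have := h.isAddTorsionFree
  have : AddMonoid.FG (DifferenceGroup I) := inferInstance
  have : IsAddTorsionFree (DifferenceGroup I) := inferInstance
  have : IsDomain (AddMonoidAlgebra K (DifferenceGroup I)) := inferInstance
  exact RingHom.ker_isPrime _

/-- In the fraction field of `A ⧸ P`, the ratio `x / y` is an `n`-th root of `l`, hence integral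
over `k`, hence in `k`. -/
lemma exists_sub_smul_mem_of_pow_sub_smul_pow_mem [IsAlgClosed k] {A : Type*} [CommRing A]
    [Algebra k A] {P : Ideal A} [hP : P.IsPrime] {x y : A} (hy : y ∉ P) {n : ℕ} (hn : n ≠ 0)
    {l : k} (h : x ^ n - l • y ^ n ∈ P) : ∃ m : k, m ^ n = l ∧ x - m • y ∈ P := by
  let D := A ⧸ P
  let F := FractionRing D
  have hinj : Function.Injective (algebraMap D F) := IsFractionRing.injective D F
  let j : A →+* F := (algebraMap D F).comp (Ideal.Quotient.mk P)
  have hj : ∀ a, j a = 0 ↔ a ∈ P := by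
    intro a
    rw [← Ideal.Quotient.eq_zero_iff_mem]
    exact map_eq_zero_iff _ hinj
  have hjk : ∀ (r : k) (a : A), j (r • a) = algebraMap k F r * j a := by
    intro r a
    rw [Algebra.smul_def, map_mul, IsScalarTower.algebraMap_apply k D F]
    rfl
  have hy0 : j y ≠ 0 := mt (hj y).1 hy
  have hz : (j x / j y) ^ n = algebraMap k F l := by
    rw [← hj, map_sub, hjk, map_pow, map_pow, sub_eq_zero] at h
    rw [div_pow, h, mul_div_cancel_right₀ _ (pow_ne_zero n hy0)]
  have hint : IsIntegral k (j x / j y) :=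
    IsIntegral.of_pow (Nat.pos_of_ne_zero hn) (hz ▸ isIntegral_algebraMap)
  obtain ⟨m, hm⟩ := minpoly.mem_range_of_degree_eq_one k _
    (IsAlgClosed.degree_eq_one_of_irreducible k (minpoly.irreducible hint))
  refine ⟨m, (algebraMap k F).injective ?_, ?_⟩
  · rw [map_pow, hm, hz]
  · rw [← hj, map_sub, hjk, hm, div_mul_cancel₀ _ hy0, sub_self]

lemma isPrimeIdeal_iff_isPrime : IsPrimeIdeal I ↔ I.IsPrime :=
  Ideal.Quotient.isDomain_iff_prime I

lemma isCellularIdeal_of_isPrime (h : I.IsPrime) : IsCellularIdeal I := by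
  refine ⟨h.ne_top, fun q => ?_⟩
  by_cases hq : monomial k q ∈ I
  · exact Or.inr (isNilpotent_mk_monomial_iff.2 ⟨1, by rwa [one_nsmul]⟩)
  · exact Or.inl (mk_mem_nonZeroDivisors_iff.2 fun f hf => (h.mem_or_mem hf).resolve_left hq)

lemma isPrimeCon_of_isPrime (h : I.IsPrime) : IsPrimeCon (inducedCon I) := by
  intro x
  induction x using AddCon.induction_on with
  | H q =>
    by_cases hq : monomial k q ∈ I
    · exact Or.inl (isNil_of_monomial_mem hq)
    · exact Or.inr (isCancellative_of_forall_mem fun f hf => (h.mem_or_mem hf).resolve_left hq)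

lemma torsionFreeOn_of_isPrime [IsAlgClosed k] (h : I.IsPrime) :
    TorsionFreeOn {x : (inducedCon I).Quotient | IsCancellative x} := by
  intro a ha b hb n hn hab
  induction a using AddCon.induction_on with
  | H a =>
    induction b using AddCon.induction_on with
    | H b =>
      obtain ⟨l, hl, hmem⟩ : inducedCon I (n • a) (n • b) := (AddCon.eq _).1 hab
      rw [monomial_nsmul, monomial_nsmul] at hmem
      have hb' := Character.not_isCancellative_of_mem h.ne_top (q := b)
      obtain ⟨m, rfl, hm⟩ := exists_sub_smul_mem_of_pow_sub_smul_pow_mem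
        (fun hb0 => hb' hb0 hb) (Nat.one_le_iff_ne_zero.1 hn) hmem
      exact (AddCon.eq _).2 ⟨m, ne_zero_pow (Nat.one_le_iff_ne_zero.1 hn) hl, hm⟩

/-- If some class is not nil, neither is `0`, so `S` is exactly the set of non-nil classes. Its
closure under addition shows that adding a non-nil class cannot identify a nil class with a non-nil
one; among non-nil classes, cancellation takes place in the free abelian group. -/
lemma IsToricCon.isPrimeCon {c : AddCon Q} (h : IsToricCon c) : IsPrimeCon c := by
  obtain ⟨S, hS, ι, N, -, ⟨e⟩⟩ := h
  intro x
  by_cases hx : IsNil x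
  · exact Or.inl hx
  refine Or.inr fun a b hab => ?_
  have h0 : ¬ IsNil (0 : c.Quotient) := by
    intro h0
    have := isCancellative_zero.subsingleton_of_isNil h0
    exact hx fun q => Subsingleton.elim _ _
  have hS' : ∀ y, y ∈ S ↔ ¬ IsNil y := by
    intro y
    rw [hS]
    refine ⟨?_, Or.inl⟩
    rintro (hy | rfl)
    exacts [hy, h0]
  have hnil : ∀ y z, x + y = x + z → IsNil y → IsNil z := by
    intro y z hyz hy
    by_contra hz
    refine (hS' _).1 (S.add_mem ((hS' x).2 hx) ((hS' z).2 hz)) ?_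
    rw [← hyz]
    exact hy.add x
  by_cases ha : IsNil a
  · exact ha.eq (hnil a b hab ha)
  · have hb : ¬ IsNil b := fun hb => ha (hnil b a hab.symm hb)
    have h1 : (⟨x, (hS' x).2 hx⟩ : S) + ⟨a, (hS' a).2 ha⟩ =
        (⟨x, (hS' x).2 hx⟩ : S) + ⟨b, (hS' b).2 hb⟩ := Subtype.ext hab
    have h2 := congrArg e h1
    rw [map_add, map_add, ← Subtype.coe_inj, AddSubmonoid.coe_add, AddSubmonoid.coe_add,
      add_right_inj, Subtype.coe_inj, e.injective.eq_iff] at h2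
    exact congrArg Subtype.val h2

lemma IsToricCon.torsionFreeOn {c : AddCon Q} (h : IsToricCon c) :
    TorsionFreeOn {x : c.Quotient | IsCancellative x} := by
  obtain ⟨S, hS, ι, N, -, ⟨e⟩⟩ := h
  intro a ha b hb n hn hab
  by_cases hs : Subsingleton c.Quotient
  · exact Subsingleton.elim _ _
  have hmem : ∀ y : c.Quotient, IsCancellative y → y ∈ S := fun y hy =>
    (hS y).2 (Or.inl fun hy' => hs (hy.subsingleton_of_isNil hy'))
  have h1 : n • (⟨a, hmem a ha⟩ : S) = n • (⟨b, hmem b hb⟩ : S) := Subtype.ext hab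
  have h2 := congrArg e h1
  rw [map_nsmul, map_nsmul, ← Subtype.coe_inj, AddSubmonoidClass.coe_nsmul,
    AddSubmonoidClass.coe_nsmul] at h2
  have h3 := nsmul_right_injective (Nat.one_le_iff_ne_zero.1 hn) h2
  exact congrArg Subtype.val (e.injective (Subtype.ext h3))

/-- Over an algebraically closed field, a binomial ideal is prime precisely if its congruence is
toric and it is maximal for its congruence. -/
theorem isPrimeIdeal_iff [AddMonoid.FG Q] [IsAlgClosed k] (hI : IsBinomialIdeal I) :
    IsPrimeIdeal I ↔ IsToricCon (inducedCon I) ∧ IsMaximalInducing (inducedCon I) I := by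
  rw [isPrimeIdeal_iff_isPrime]
  constructor
  · intro h
    -- For a prime ideal the non-nil classes are the cancellative ones, except that in the trivial
    -- quotient the only class is both nil and cancellative; the clause `x = 0` covers it.
    refine ⟨⟨cancellatives _, fun x => ?_, (torsionFreeOn_of_isPrime h).isAffineSemigroup⟩,
      (isCellularIdeal_of_isPrime h).isMaximalInducing hI⟩
    rw [mem_cancellatives]
    constructor
    · intro hx
      by_cases hn : IsNil x
      · have := hx.subsingleton_of_isNil hn
        exact Or.inr (Subsingleton.elim _ _)
      · exact Or.inl hn
    · rintro (hx | rfl)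
      · exact (isPrimeCon_of_isPrime h x).resolve_left hx
      · exact isCancellative_zero
  · rintro ⟨hc, h⟩
    obtain ⟨χ⟩ := hI.nonempty_character h.1.2.1 k
    rw [χ.eq_ker_of_isPrimeCon hc.isPrimeCon h]
    exact χ.ker_isPrime hc.torsionFreeOn

end Toric

/-! ### Primary ideals and associated primes -/

section Primary

variable {R : Type*} [CommRing R] {I : Ideal R}

lemma exists_mem_associatedPrimes_of_isPrimary [IsNoetherianRing R] (hI : I.IsPrimary) :
    ∃! p : Ideal R, p ∈ associatedPrimes R (R ⧸ I) := by
  rw [associatedPrimes.eq_singleton_of_isPrimary hI]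
  exact ⟨I.radical, rfl, fun _ h => h⟩

/-- Minimal primes over `I` are associated, so all equal `P`, and `P` lies in the radical. Zero
divisors modulo `I` lie in some associated prime, hence in `P`. -/
lemma isPrimary_of_existsUnique_mem_associatedPrimes [IsNoetherianRing R]
    (h : ∃! p : Ideal R, p ∈ associatedPrimes R (R ⧸ I)) : I.IsPrimary := by
  obtain ⟨P, hP, huniq⟩ := h
  have htop : I ≠ ⊤ := by
    rintro rfl
    have : Subsingleton (R ⧸ (⊤ : Ideal R)) := Ideal.Quotient.subsingleton_iff.2 rfl
    rw [associatedPrimes.eq_empty_of_subsingleton] at hP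
    exact hP
  have hrad : P ≤ I.radical := by
    rw [← Ideal.sInf_minimalPrimes]
    refine le_sInf fun p hp => (huniq p ?_).ge
    refine Module.associatedPrimes.minimalPrimes_annihilator_subset_associatedPrimes R (R ⧸ I) ?_
    rwa [Ideal.annihilator_quotient]
  refine Ideal.isPrimary_iff.2 ⟨htop, fun {x y} hxy => ?_⟩
  by_contra! hcon
  obtain ⟨hx, hy⟩ := hcon
  have hy' : y ∈ {r : R | ∃ m : R ⧸ I, m ≠ 0 ∧ r • m = 0} := by
    refine ⟨Ideal.Quotient.mk I x, mt Ideal.Quotient.eq_zero_iff_mem.1 hx, ?_⟩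
    rw [Algebra.smul_def, Ideal.Quotient.algebraMap_eq, ← map_mul, mul_comm]
    exact Ideal.Quotient.eq_zero_iff_mem.2 hxy
  rw [← biUnion_associatedPrimes_eq_zero_divisors] at hy'
  obtain ⟨p, hp, hyp⟩ := Set.mem_iUnion₂.1 hy'
  rw [huniq p hp] at hyp
  exact hy (hrad hyp)

end Primary

/-! ### Primitive congruences give primary ideals -/

section Primitive

variable {k : Type v} [Field k] {Q : Type u} [AddCommMonoid Q] {I : Ideal (AddMonoidAlgebra k Q)}

/-- The exponents that are cancellative modulo an ideal. -/
def cancellativeExponents (I : Ideal (AddMonoidAlgebra k Q)) : Set Q :=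
  {q : Q | IsCancellative (q : (inducedCon I).Quotient)}

lemma add_mem_cancellativeExponents_iff {p q : Q} : p + q ∈ cancellativeExponents I ↔
    p ∈ cancellativeExponents I ∧ q ∈ cancellativeExponents I :=
  isCancellative_add_iff (x := (p : (inducedCon I).Quotient)) (y := q)

lemma zero_mem_cancellativeExponents : 0 ∈ cancellativeExponents I :=
  isCancellative_zero

lemma mem_cancellativeExponents_congr {p q : Q} (h : inducedCon I p q) :
    p ∈ cancellativeExponents I ↔ q ∈ cancellativeExponents I := by
  change IsCancellative (p : (inducedCon I).Quotient) ↔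
    IsCancellative (q : (inducedCon I).Quotient)
  rw [(AddCon.eq _).2 h]

/-- Adding a cancellative exponent neither creates nor destroys cancellativity. -/
lemma restrict_cancellative_mul (g f : AddMonoidAlgebra k Q) :
    restrict (cancellativeExponents I) (restrict (cancellativeExponents I) g * f) =
      restrict (cancellativeExponents I) g * restrict (cancellativeExponents I) f :=
  restrict_mul_restrict (fun s hs q => by
    rw [add_mem_cancellativeExponents_iff, and_iff_right hs]) g f

/-- In a binomial ideal that is maximal for a congruence with partly cancellative quotient, an
element supported on cancellative exponents that kills a nonzero monomial is zero. -/
lemma restrict_mem_of_mul_monomial_mem (h : IsMaximalInducing (inducedCon I) I) {q : Q}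
    (hc : IsPartlyCancellative (q : (inducedCon I).Quotient)) (hq : monomial k q ∉ I)
    {f : AddMonoidAlgebra k Q}
    (hf : restrict (cancellativeExponents I) f * monomial k q ∈ I) :
    restrict (cancellativeExponents I) f ∈ I := by
  have hI := h.1.1
  have hadd : ∀ p ∈ cancellativeExponents I, monomial k (p + q) ∉ I := fun p hp hpq =>
    hq (monomial_mem_of_add_mem hp hpq)
  -- Partial cancellativity requires the common translate not to be nil; maximality ensures this, as
  -- nil monomials would lie in `I`.
  have hcancel : ∀ p ∈ cancellativeExponents I, ∀ r ∈ cancellativeExponents I,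
      inducedCon I (r + q) (p + q) → inducedCon I r p := by
    intro p hp r hr hrp
    by_cases hs : Subsingleton (inducedCon I).Quotient
    · exact (AddCon.eq _).1 (hs.elim _ _)
    · refine (AddCon.eq _).1 (hc _ _ hr hp ((AddCon.eq _).2 ?_) fun hn => ?_)
      · rw [add_comm r, add_comm p] at hrp
        exact hrp
      · have := h.monomial_mem_of_isNil hs (q := q + r) hn
        rw [add_comm] at this
        exact hadd r hr this
  refine mem_of_forall_restrict_class_mem fun p => ?_
  by_cases hp : p ∈ cancellativeExponents I
  · obtain ⟨l, hl⟩ := exists_restrict_class_sub_mem I p (restrict (cancellativeExponents I) f)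
    have h1 : restrict {r | inducedCon I r (p + q)}
        (restrict (cancellativeExponents I) f * monomial k q) ∈ I :=
      hI.restrict_mem (fun a b hab => ⟨fun h => (inducedCon I).trans ((inducedCon I).symm hab) h,
        fun h => (inducedCon I).trans hab h⟩) hf
    have h2 : restrict {r | inducedCon I r (p + q)}
        (restrict (cancellativeExponents I) f * monomial k q) =
        restrict {r | inducedCon I r p} (restrict (cancellativeExponents I) f) *
          monomial k q := by
      refine restrict_induction (motive := fun f => restrict {r | inducedCon I r (p + q)}
        (f * monomial k q) = restrict {r | inducedCon I r p} f * monomial k q)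
        (cancellativeExponents I) f (by simp) (fun f g hf hg => ?_) fun r a ha => ?_
      · rw [add_mul, map_add, hf, hg, map_add, add_mul]
      · rw [smul_mul_assoc, map_smul, map_smul, ← monomial_add, smul_mul_assoc]
        by_cases hap : inducedCon I a p
        · rw [restrict_monomial_of_mem (S := {r | inducedCon I r p}) hap,
            restrict_monomial_of_mem (S := {r | inducedCon I r (p + q)})
              ((inducedCon I).add hap ((inducedCon I).refl q)), monomial_add]
        · rw [restrict_monomial_of_notMem (S := {r | inducedCon I r p}) hap,
            restrict_monomial_of_notMem (S := {r | inducedCon I r (p + q)})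
              (mt (hcancel p hp a ha) hap), zero_mul]
    rw [h2] at h1
    have h3 := I.sub_mem h1 (I.mul_mem_right (monomial k q) hl)
    rw [← sub_mul, sub_sub_cancel, smul_mul_assoc, ← monomial_add] at h3
    have h4 : l = 0 := by
      by_contra h0
      rw [smul_mem_iff_mem h0] at h3
      exact hadd p hp h3
    simpa [h4] using hl
  · rw [restrict_restrict]
    have hS : {q | inducedCon I q p} ∩ cancellativeExponents I = ∅ :=
      Set.eq_empty_of_forall_notMem fun a ⟨ha, ha'⟩ =>
        hp ((mem_cancellativeExponents_congr ha).1 ha')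
    rw [hS]
    convert I.zero_mem
    ext a
    exact coeff_restrict_of_notMem (Set.notMem_empty a) f

variable (I) in
/-- Two exponents are equivalent if they have congruent translates by cancellative exponents. -/
def translateSetoid : Setoid Q where
  r p q := ∃ a ∈ cancellativeExponents I, ∃ b ∈ cancellativeExponents I,
    inducedCon I (a + p) (b + q)
  iseqv :=
    { refl := fun p => ⟨0, zero_mem_cancellativeExponents, 0, zero_mem_cancellativeExponents,
        (inducedCon I).refl _⟩
      symm := fun ⟨a, ha, b, hb, h⟩ => ⟨b, hb, a, ha, (inducedCon I).symm h⟩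
      trans := by
        rintro p q r ⟨a, ha, b, hb, h⟩ ⟨a', ha', b', hb', h'⟩
        refine ⟨a' + a, add_mem_cancellativeExponents_iff.2 ⟨ha', ha⟩, b + b',
          add_mem_cancellativeExponents_iff.2 ⟨hb, hb'⟩, ?_⟩
        have h1 := (inducedCon I).add ((inducedCon I).refl a') h
        have h2 := (inducedCon I).add ((inducedCon I).refl b) h'
        rw [add_left_comm a' b q] at h1
        rw [add_assoc, add_assoc]
        exact (inducedCon I).trans h1 h2 }

lemma translateSetoid_add_left_iff {a p q : Q} (ha : a ∈ cancellativeExponents I) :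
    translateSetoid I (a + p) q ↔ translateSetoid I p q := by
  have h : translateSetoid I (a + p) p := ⟨0, zero_mem_cancellativeExponents, a, ha, by
    rw [zero_add]; exact (inducedCon I).refl _⟩
  exact ⟨fun h' => (translateSetoid I).trans ((translateSetoid I).symm h) h',
    fun h' => (translateSetoid I).trans h h'⟩

lemma translateSetoid_of_inducedCon {p q : Q} (h : inducedCon I p q) : translateSetoid I p q :=
  ⟨0, zero_mem_cancellativeExponents, 0, zero_mem_cancellativeExponents, by
    rwa [zero_add, zero_add]⟩

/-- After multiplication with a cancellative monomial, elements supported on a single class of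
`translateSetoid` become multiples of a given monomial modulo the ideal. -/
lemma exists_monomial_mul_sub_mem (q : Q) (f : AddMonoidAlgebra k Q) :
    ∃ a ∈ cancellativeExponents I, ∃ g : AddMonoidAlgebra k Q,
      monomial k a * restrict {p | translateSetoid I p q} f -
        restrict (cancellativeExponents I) g * monomial k q ∈ I := by
  refine restrict_induction (motive := fun f => ∃ a ∈ cancellativeExponents I,
    ∃ g : AddMonoidAlgebra k Q,
      monomial k a * f - restrict (cancellativeExponents I) g * monomial k q ∈ I) _ f ?_ ?_ ?_
  · exact ⟨0, zero_mem_cancellativeExponents, 0, by simp⟩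
  · rintro f₁ f₂ ⟨a₁, ha₁, g₁, h₁⟩ ⟨a₂, ha₂, g₂, h₂⟩
    -- A common denominator: each numerator is multiplied by the other denominator.
    refine ⟨a₁ + a₂, add_mem_cancellativeExponents_iff.2 ⟨ha₁, ha₂⟩,
      restrict (cancellativeExponents I) (monomial k a₂) * g₁ +
        restrict (cancellativeExponents I) (monomial k a₁) * g₂, ?_⟩
    rw [map_add, restrict_cancellative_mul, restrict_cancellative_mul,
      restrict_monomial_of_mem ha₁, restrict_monomial_of_mem ha₂, monomial_add]
    convert I.add_mem (I.mul_mem_left (monomial k a₂) h₁) (I.mul_mem_left (monomial k a₁) h₂)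
      using 1
    ring
  · rintro r p ⟨a, ha, b, hb, l, -, h⟩
    refine ⟨a, ha, (r * l) • monomial k b, ?_⟩
    rw [map_smul, restrict_monomial_of_mem hb, mul_smul_comm, smul_mul_assoc, ← monomial_add,
      ← monomial_add, mul_smul, ← smul_sub]
    exact Submodule.smul_of_tower_mem I r h

/-- Modulo a binomial ideal that is maximal for a primitive congruence, nonzero elements supported
on cancellative exponents are nonzerodivisors. -/
lemma mem_of_restrict_mul_mem [AddMonoid.FG Q] (h : IsMaximalInducing (inducedCon I) I)
    (hc : IsPrimitiveCon (inducedCon I)) {g f : AddMonoidAlgebra k Q}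
    (hg : restrict (cancellativeExponents I) g ∉ I)
    (hf : restrict (cancellativeExponents I) g * f ∈ I) : f ∈ I := by
  have hI := h.1.1
  obtain ⟨χ⟩ := hI.nonempty_character h.1.2.1 (AlgebraicClosure k)
  have hker : (RingHom.ker χ.toGroupAlgebra).IsPrime := χ.ker_isPrime hc.2
  have hmem : ∀ f, f ∈ RingHom.ker χ.toGroupAlgebra ↔ restrict (cancellativeExponents I) f ∈ I :=
    fun f => χ.mem_ker_iff hI h.1.2.1
  have hmem' : ∀ f, restrict (cancellativeExponents I) f ∈ RingHom.ker χ.toGroupAlgebra ↔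
      restrict (cancellativeExponents I) f ∈ I := fun f => by
    rw [hmem, restrict_restrict, Set.inter_self]
  refine mem_of_forall_restrict_fiber_mem (fun q : Q => Quotient.mk (translateSetoid I) q)
    fun x => ?_
  induction x using Quotient.inductionOn with
  | h q =>
    have hT : (fun q : Q => Quotient.mk (translateSetoid I) q) ⁻¹'
        {Quotient.mk (translateSetoid I) q} = {p | translateSetoid I p q} :=
      Set.ext fun p => Quotient.eq (r := translateSetoid I)
    rw [hT]
    -- The classes of `translateSetoid` are unions of congruence classes and are stable under
    -- cancellative translations, so the relation splits into one for each piece of `f`.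
    have h1 : restrict (cancellativeExponents I) g * restrict {p | translateSetoid I p q} f ∈ I := by
      rw [← restrict_mul_restrict fun s hs p => translateSetoid_add_left_iff hs]
      refine hI.restrict_mem (fun p r hpr => ?_) hf
      have hpr' := translateSetoid_of_inducedCon hpr
      exact ⟨fun h' => (translateSetoid I).trans ((translateSetoid I).symm hpr') h',
        fun h' => (translateSetoid I).trans hpr' h'⟩
    -- Up to the nonzerodivisor `t ^ a`, the piece of `f` is `w * t ^ q` with `w` cut down to its
    -- cancellative part. Partial cancellativity of `q` removes `t ^ q`, and primality of the kernel
    -- separates `g` from `w`.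
    obtain ⟨a, ha, w, hw⟩ := exists_monomial_mul_sub_mem (I := I) q f
    suffices hs : restrict (cancellativeExponents I) w * monomial k q ∈ I by
      have := I.add_mem hw hs
      rw [sub_add_cancel] at this
      exact hI.mem_of_monomial_mul_mem ha this
    by_cases hq : monomial k q ∈ I
    · exact I.mul_mem_left _ hq
    refine I.mul_mem_right _ ((hmem' w).1 ?_)
    refine (hker.mem_or_mem (x := restrict (cancellativeExponents I) g) ?_).resolve_left
      (mt (hmem' g).1 hg)
    rw [← restrict_cancellative_mul, hmem']
    refine restrict_mem_of_mul_monomial_mem h (hc.1.2 q) hq ?_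
    rw [restrict_cancellative_mul]
    have h2 := I.sub_mem (I.mul_mem_left (monomial k a) h1)
      (I.mul_mem_left (restrict (cancellativeExponents I) g) hw)
    convert h2 using 1
    ring

lemma restrict_compl_cancellative_mem_radical (h : IsMaximalInducing (inducedCon I) I)
    (hc : IsPrimaryCon (inducedCon I)) (f : AddMonoidAlgebra k Q) :
    restrict (cancellativeExponents I)ᶜ f ∈ I.radical := by
  refine restrict_induction (motive := fun f => f ∈ I.radical) _ f (Ideal.zero_mem _)
    (fun f g => Ideal.add_mem _) fun r q hq => ?_
  refine Submodule.smul_of_tower_mem I.radical r ?_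
  have h1 := ((isCellularIdeal_of_isPrimaryCon h hc).2 q).resolve_left
    (mt h.1.1.isCancellative_iff.2 hq)
  obtain ⟨n, hn⟩ := isNilpotent_mk_monomial_iff.1 h1
  exact ⟨n, by rwa [← monomial_nsmul]⟩

/-- Split `y` into its cancellative part `y₀` and the rest `y₁`, which is nilpotent modulo `I`. If
`y₀ ∈ I`, then `y` is nilpotent. Otherwise `y₀` is a nonzerodivisor, and `y = y₀ + y₁` divides `y₀ ^
n - (-y₁) ^ n`, so `x * y ∈ I` yields `y₀ ^ n * x ∈ I` and then `x ∈ I`. -/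
lemma isPrimary_of_isPrimitiveCon [AddMonoid.FG Q] (h : IsMaximalInducing (inducedCon I) I)
    (hc : IsPrimitiveCon (inducedCon I)) : I.IsPrimary := by
  refine Ideal.isPrimary_iff.2 ⟨h.1.2.1, fun {x y} hxy => ?_⟩
  have hrad := restrict_compl_cancellative_mem_radical h hc.1.1 y
  have hy := restrict_compl_add (cancellativeExponents I) y
  set y₀ := restrict (cancellativeExponents I) y
  set y₁ := restrict (cancellativeExponents I)ᶜ y
  by_cases hy₀ : y₀ ∈ I
  · right
    rw [← hy]
    exact Ideal.add_mem _ (Ideal.le_radical hy₀) hrad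
  left
  obtain ⟨n, hn⟩ := hrad
  have h1 : (y₀ ^ n - (-y₁) ^ n) * x ∈ I := by
    obtain ⟨z, hz⟩ := sub_dvd_pow_sub_pow y₀ (-y₁) n
    rw [hz, sub_neg_eq_add, hy]
    convert I.mul_mem_left z hxy using 1
    ring
  have h2 : y₀ ^ n * x ∈ I := by
    have h3 : (-y₁) ^ n * x ∈ I := by
      rw [neg_pow]
      exact I.mul_mem_right _ (I.mul_mem_left _ hn)
    convert I.add_mem h1 h3 using 1
    ring
  clear h1 hn
  induction n with
  | zero => simpa using h2
  | succ n ih =>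
    rw [pow_succ', mul_assoc] at h2
    exact ih (mem_of_restrict_mul_mem h hc hy₀ h2)

lemma isNoetherianRing_addMonoidAlgebra [AddMonoid.FG Q] :
    IsNoetherianRing (AddMonoidAlgebra k Q) :=
  Algebra.FiniteType.isNoetherianRing k _

theorem isPrimaryIdeal_of_isPrimitiveCon [AddMonoid.FG Q]
    (h : IsMaximalInducing (inducedCon I) I) (hc : IsPrimitiveCon (inducedCon I)) :
    IsPrimaryIdeal I :=
  have := isNoetherianRing_addMonoidAlgebra (k := k) (Q := Q)
  exists_mem_associatedPrimes_of_isPrimary (isPrimary_of_isPrimitiveCon h hc)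

end Primitive

/-! ### Primary ideals in characteristic zero have primitive congruences -/

section Converse

variable {k : Type v} [Field k] {Q : Type u} [AddCommMonoid Q] {I : Ideal (AddMonoidAlgebra k Q)}

lemma isCellularIdeal_of_isPrimary (h : I.IsPrimary) : IsCellularIdeal I := by
  obtain ⟨htop, h⟩ := Ideal.isPrimary_iff.1 h
  refine ⟨htop, fun q => ?_⟩
  by_cases hq : monomial k q ∈ I.radical
  · obtain ⟨n, hn⟩ := hq
    exact Or.inr (isNilpotent_mk_monomial_iff.2 ⟨n, by rwa [monomial_nsmul]⟩)
  · refine Or.inl (mk_mem_nonZeroDivisors_iff.2 fun f hf => ?_)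
    rw [mul_comm] at hf
    exact (h hf).resolve_right hq

lemma monomial_notMem_radical (hI : IsBinomialIdeal I) (htop : I ≠ ⊤) {q : Q}
    (hq : IsCancellative (q : (inducedCon I).Quotient)) : monomial k q ∉ I.radical := by
  rintro ⟨n, hn⟩
  have h1 : ∀ n : ℕ, monomial k q ^ n ∈ I → (1 : AddMonoidAlgebra k Q) ∈ I := by
    intro n
    induction n with
    | zero => simp
    | succ n ih =>
      intro h
      rw [pow_succ'] at h
      exact ih (hI.mem_of_monomial_mul_mem hq h)
  exact htop ((Ideal.eq_top_iff_one I).2 (h1 n hn))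

/-- Modulo the prime radical, `t ^ a` equals `m • t ^ b` with `m ^ n = l`. Factor `t ^ (n • a) - l •
t ^ (n • b)` by `t ^ a - m • t ^ b`: the cofactor is `n • (m • t ^ b) ^ (n - 1)` modulo the radical,
which is nonzero in characteristic zero. As `I` is primary, the first factor lies in `I`. -/
lemma torsionFreeOn_of_isPrimary [IsAlgClosed k] [CharZero k] (hI : IsBinomialIdeal I)
    (h : I.IsPrimary) : TorsionFreeOn {x : (inducedCon I).Quotient | IsCancellative x} := by
  intro a ha b hb n hn hab
  have hn0 := Nat.one_le_iff_ne_zero.1 hn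
  obtain ⟨htop, hprim⟩ := Ideal.isPrimary_iff.1 h
  have hP : I.radical.IsPrime := Ideal.isPrime_radical h
  induction a using AddCon.induction_on with
  | H a =>
    induction b using AddCon.induction_on with
    | H b =>
      obtain ⟨l, hl, hmem⟩ : inducedCon I (n • a) (n • b) := (AddCon.eq _).1 hab
      rw [monomial_nsmul, monomial_nsmul] at hmem
      have hb' := monomial_notMem_radical hI htop hb
      obtain ⟨m, rfl, hm⟩ := exists_sub_smul_mem_of_pow_sub_smul_pow_mem hb' hn0
        (Ideal.le_radical hmem)
      have hm0 : m ≠ 0 := ne_zero_pow hn0 hl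
      refine (AddCon.eq _).2 ⟨m, hm0, ?_⟩
      rw [← smul_pow, ← (Commute.all _ _).mul_geom_sum₂] at hmem
      refine (hprim hmem).resolve_right fun hsum => hb' ?_
      have heq := Ideal.Quotient.eq.2 hm
      rw [← Ideal.Quotient.eq_zero_iff_mem, map_sum] at hsum
      simp only [map_mul, map_pow, heq] at hsum
      rw [Finset.sum_congr rfl (g := fun _ => Ideal.Quotient.mk I.radical
        ((m • monomial k b) ^ (n - 1))) fun i hi => by
          rw [← pow_add, map_pow]
          congr 1
          have := Finset.mem_range.1 hi
          omega, Finset.sum_const, Finset.card_range, ← map_nsmul,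
        Ideal.Quotient.eq_zero_iff_mem, ← Nat.cast_smul_eq_nsmul k,
        smul_mem_iff_mem (Nat.cast_ne_zero.2 hn0)] at hsum
      exact (smul_mem_iff_mem hm0).1 (hP.mem_of_pow_mem _ hsum)

/-- From `t ^ q * (t ^ a - l • t ^ b) ∈ I` with `t ^ q ∉ I`, some power of the binomial lies in `I`.
If `a` and `b` were different classes, torsion-freeness would isolate `t ^ (n • a)` in its
expansion, and homogeneity would put this cancellative monomial into `I`. -/
lemma isPartlyCancellative_of_isPrimary [IsAlgClosed k] [CharZero k] (hI : IsBinomialIdeal I)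
    (h : I.IsPrimary) (x : (inducedCon I).Quotient) : IsPartlyCancellative x := by
  intro a b ha hb hab hnil
  have htf := torsionFreeOn_of_isPrimary hI h
  obtain ⟨htop, hprim⟩ := Ideal.isPrimary_iff.1 h
  induction x using AddCon.induction_on with
  | H q =>
    induction a using AddCon.induction_on with
    | H a =>
      induction b using AddCon.induction_on with
      | H b =>
        obtain ⟨l, -, hmem⟩ : inducedCon I (q + a) (q + b) := (AddCon.eq _).1 hab
        rw [monomial_add, monomial_add, ← mul_smul_comm, ← mul_sub] at hmem
        have hq : monomial k q ∉ I := fun hq => hnil <| by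
          rw [add_comm]
          exact (isNil_of_monomial_mem hq).add _
        obtain ⟨n, hn⟩ := (hprim hmem).resolve_left hq
        by_contra hne
        -- Cancelling `i • a` would leave `(n - i) • b` congruent to `(n - i) • a` with `n - i ≥ 1`.
        have hterm : ∀ i ∈ Finset.range n, ¬ inducedCon I (i • a + (n - i) • b) (n • a) := by
          intro i hi h
          have hi' := Finset.mem_range.1 hi
          have h1 : i • a + (n - i) • a = n • a := by
            rw [← add_nsmul, Nat.add_sub_cancel' hi'.le]
          rw [← h1] at h
          have hia : IsCancellative ((i • a : Q) : (inducedCon I).Quotient) :=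
            nsmul_mem (S := cancellatives (inducedCon I).Quotient) ha i
          have h2 := (AddCon.eq _).2 (isCancellative_coe_iff.1 hia _ _ h)
          exact hne (htf _ ha _ hb (n - i) (by omega) h2.symm)
        have h1 := hI.restrict_mem (S := {r | inducedCon I r (n • a)}) (fun p r hpr =>
          ⟨fun h => (inducedCon I).trans ((inducedCon I).symm hpr) h,
            fun h => (inducedCon I).trans hpr h⟩) hn
        rw [sub_eq_add_neg, ← neg_smul, add_pow, Finset.sum_range_succ, map_add, map_sum,
          Finset.sum_eq_zero fun i hi => ?_, zero_add, Nat.sub_self, pow_zero, mul_one,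
          Nat.choose_self, Nat.cast_one, mul_one, ← monomial_nsmul,
          restrict_monomial_of_mem (S := {r | inducedCon I r (n • a)})
            ((inducedCon I).refl _), monomial_nsmul] at h1
        · exact monomial_notMem_radical hI htop ha ⟨n, h1⟩
        · rw [smul_pow, ← monomial_nsmul, ← monomial_nsmul, mul_smul_comm, ← monomial_add,
            mul_comm, ← nsmul_eq_mul, map_nsmul, map_smul,
            restrict_monomial_of_notMem (S := {r | inducedCon I r (n • a)}) (hterm i hi),
            smul_zero, smul_zero]

theorem isPrimitiveCon_and_isMaximalInducing_of_isPrimaryIdeal [AddMonoid.FG Q] [IsAlgClosed k]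
    [CharZero k] (hI : IsBinomialIdeal I) (h : IsPrimaryIdeal I) :
    IsPrimitiveCon (inducedCon I) ∧ IsMaximalInducing (inducedCon I) I := by
  have := isNoetherianRing_addMonoidAlgebra (k := k) (Q := Q)
  have hprim := isPrimary_of_existsUnique_mem_associatedPrimes h
  have hcell := isCellularIdeal_of_isPrimary hprim
  exact ⟨⟨⟨hcell.isPrimaryCon hI, isPartlyCancellative_of_isPrimary hI hprim⟩,
    torsionFreeOn_of_isPrimary hI hprim⟩, hcell.isMaximalInducing hI⟩

end Converse

end BinomialIdeals

theorem theoremt {k : Type*} [Field k] {Q : Type*} [AddCommMonoid Q] [AddMonoid.FG Q]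
    (I : Ideal (AddMonoidAlgebra k Q)) (hI : BinomialIdeals.IsBinomialIdeal I) :
    (BinomialIdeals.IsCellularIdeal I ↔
      BinomialIdeals.IsPrimaryCon (BinomialIdeals.inducedCon I) ∧
        BinomialIdeals.IsMaximalInducing (BinomialIdeals.inducedCon I) I) ∧
    (BinomialIdeals.IsMesoprimaryIdeal I ↔
      BinomialIdeals.IsMesoprimaryCon (BinomialIdeals.inducedCon I) ∧
        BinomialIdeals.IsMaximalInducing (BinomialIdeals.inducedCon I) I) ∧
    (BinomialIdeals.IsMesoprimeIdeal I ↔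
      BinomialIdeals.IsPrimeCon (BinomialIdeals.inducedCon I) ∧
        BinomialIdeals.IsMaximalInducing (BinomialIdeals.inducedCon I) I) ∧
    (IsAlgClosed k →
      (BinomialIdeals.IsPrimeIdeal I ↔
        BinomialIdeals.IsToricCon (BinomialIdeals.inducedCon I) ∧
          BinomialIdeals.IsMaximalInducing (BinomialIdeals.inducedCon I) I)) ∧
    (BinomialIdeals.IsPrimitiveCon (BinomialIdeals.inducedCon I) ∧
        BinomialIdeals.IsMaximalInducing (BinomialIdeals.inducedCon I) I →
      BinomialIdeals.IsPrimaryIdeal I) ∧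
    (IsAlgClosed k → CharZero k → BinomialIdeals.IsPrimaryIdeal I →
      BinomialIdeals.IsPrimitiveCon (BinomialIdeals.inducedCon I) ∧
        BinomialIdeals.IsMaximalInducing (BinomialIdeals.inducedCon I) I) := by
  open BinomialIdeals in
  exact ⟨isCellularIdeal_iff hI, isMesoprimaryIdeal_iff I, isMesoprimeIdeal_iff hI,
    fun _ => isPrimeIdeal_iff hI, fun h => isPrimaryIdeal_of_isPrimitiveCon h.2 h.1,
    fun _ _ h => isPrimitiveCon_and_isMaximalInducing_of_isPrimaryIdeal hI h⟩
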